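/- Let $G$ be a group and $t_1,\dots,t_r\in G$ involutions; for $J\subseteq\{1,\dots,r\}$ put $G_J=\langle t_j : j\in J\rangle$ (so $G_\emptyset=1$), writing $G_{j_1\cdots j_k}$ for $G_{\{j_1,\dots,j_k\}}$. Then $\{t_1,\dots,t_r\}$ is a C-string of rank $r$ for $G$ if (i) $G=\langle t_1,\dots,t_r\rangle$, (ii) $t_i$ and $t_j$ commute whenever $|i-j|\ge 2$, and (iii) $G_J\cap G_K=G_{J\cap K}$ for all $J,K\subseteq\{1,\dots,r\}$. Its Schläfli symbol is $[p_1,\dots,p_{r-1}]$, where $p_i$ is the order of $t_it_{i+1}$. A C-string of rank $r$ for $G$ is unravelled if, for every normal subgroup $N$ of $G$ with $1\ne N\ne G$, the images $\bar t_1,\dots,\bar t_r$ of $t_1,\dots,t_r$ in $G/N$ either are not pairwise distinct, or are pairwise distinct but do not form a C-string for $G/N$. **Theorem.** Let $n\ge 5$ be odd, and let $\mathrm{B}_n$ be the Coxeter group of type $\mathrm B_n$. In $\mathrm{Sym}(2n)$, the symmetric group on $\{1,\dots,2n\}$, put $$t_1=\prod_{i=0}^{\lfloor (n-2)/2\rfloor}(1+2i,\,2+2i)(n+1+2i,\,n+2+2i),$$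 $$t_2=\prod_{i=1}^{\lfloor (n-3)/2\rfloor}(2+2i,\,3+2i)(n+2+2i,\,n+3+2i),$$ $$t_3=(1,3)(2,4)(n+1,n+3)(n+2,n+4),$$ $$t_4=(1,2)(n+1,n+2)\prod_{i=1}^{n-2}(2+i,\,n+2+i).$$ Then $G=\langle t_1,t_2,t_3,t_4\rangle$ is isomorphic to $\mathrm B_n$, and $\{t_1,t_2,t_3,t_4\}$ is a C-string of rank $4$ for $G$ with Schläfli symbol $[2n-4,\,6,\,4]$. Moreover $G_{123}\cong\mathrm{Sym}(n)$ and $G_{234}\cong\mathbb Z_2\times\mathrm{Sym}(5)$. If $n>5$, this C-string is unravelled. -/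

import Mathlib

/-- For a family `t` of elements of a group and a set `J` of indices, the subgroup `G_J`
generated by the `t j` with `j ∈ J` (the trivial subgroup when `J` is empty). -/
def subgroupOn {G : Type*} [Group G] {r : ℕ} (t : Fin r → G) (J : Set (Fin r)) : Subgroup G :=
  Subgroup.closure (t '' J)

/-- `t 0, …, t (r - 1)` is a C-string of rank `r` for the group `G`. The `t i` are pairwise
distinct automatically: for `i ≠ j` the intersection property gives `G_{i} ∩ G_{j} = 1`. -/
structure IsCString {G : Type*} [Group G] {r : ℕ} (t : Fin r → G) : Prop where
  /-- Every `t i` is an involution. -/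
  involution : ∀ i, orderOf (t i) = 2
  /-- The `t i` generate `G`. -/
  generates : Subgroup.closure (Set.range t) = ⊤
  /-- `t i` and `t j` commute whenever `|i - j| ≥ 2`. -/
  commute : ∀ i j : Fin r, 2 ≤ |((i : ℕ) : ℤ) - ((j : ℕ) : ℤ)| → Commute (t i) (t j)
  /-- The intersection property. -/
  inter : ∀ J K : Set (Fin r), subgroupOn t J ⊓ subgroupOn t K = subgroupOn t (J ∩ K)

/-- The string `t` has Schläfli symbol `[p 0, …, p (r - 1)]`: `p i` is the order of the product
of the `i`-th and the `(i + 1)`-st element. -/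
def HasSchlafliSymbol {G : Type*} [Group G] {r : ℕ} (t : Fin (r + 1) → G) (p : Fin r → ℕ) : Prop :=
  ∀ i : Fin r, orderOf (t i.castSucc * t i.succ) = p i

/-- The C-string `t` is `N`-unravelled: its image in `G ⧸ N` has fewer than `r` elements, or it
has `r` elements but is not a C-string for `G ⧸ N`. -/
def IsUnravelledAt {G : Type*} [Group G] {r : ℕ} (t : Fin r → G) (N : Subgroup G) [N.Normal] :
    Prop :=
  (Set.range fun i => (t i : G ⧸ N)).ncard < r ∨
    ((Set.range fun i => (t i : G ⧸ N)).ncard = r ∧ ¬ IsCString fun i => (t i : G ⧸ N))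

/-- `t` is an unravelled C-string for `G`. -/
def IsUnravelledCString {G : Type*} [Group G] {r : ℕ} (t : Fin r → G) : Prop :=
  IsCString t ∧
    ∀ (N : Subgroup G) [N.Normal], N ≠ ⊥ → N ≠ ⊤ → IsUnravelledAt t N

/-- The set `Ω = {1, …, 2n}`. -/
abbrev Omega (n : ℕ) : Type := {k : ℕ // k ∈ Finset.Icc 1 (2 * n)}

/-- The transposition `(a, b)` in `Sym(Ω)`, for points `a, b` of `Ω = {1, …, 2n}`
(and the identity when `a` or `b` is not in `Ω`). -/
def transp (n a b : ℕ) : Equiv.Perm (Omega n) :=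
  if h : a ∈ Finset.Icc 1 (2 * n) ∧ b ∈ Finset.Icc 1 (2 * n) then
    Equiv.swap ⟨a, h.1⟩ ⟨b, h.2⟩
  else 1

/-- `∏_{i = 0}^{⌊(n-2)/2⌋} (1 + 2i, 2 + 2i)(n + 1 + 2i, n + 2 + 2i)`. -/
def perm1 (n : ℕ) : Equiv.Perm (Omega n) :=
  ((List.range ((n - 2) / 2 + 1)).map fun i =>
    transp n (1 + 2 * i) (2 + 2 * i) * transp n (n + 1 + 2 * i) (n + 2 + 2 * i)).prod

/-- `∏_{i = 1}^{⌊(n-3)/2⌋} (2 + 2i, 3 + 2i)(n + 2 + 2i, n + 3 + 2i)`. -/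
def perm2 (n : ℕ) : Equiv.Perm (Omega n) :=
  ((List.range' 1 ((n - 3) / 2)).map fun i =>
    transp n (2 + 2 * i) (3 + 2 * i) * transp n (n + 2 + 2 * i) (n + 3 + 2 * i)).prod

/-- `(1, 3)(2, 4)(n + 1, n + 3)(n + 2, n + 4)`. -/
def perm3 (n : ℕ) : Equiv.Perm (Omega n) :=
  transp n 1 3 * transp n 2 4 * transp n (n + 1) (n + 3) * transp n (n + 2) (n + 4)

/-- `(1, 2)(n + 1, n + 2) ∏_{i = 1}^{n-2} (2 + i, n + 2 + i)`. -/
def perm4 (n : ℕ) : Equiv.Perm (Omega n) :=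
  transp n 1 2 * transp n (n + 1) (n + 2) *
    ((List.range' 1 (n - 2)).map fun i => transp n (2 + i) (n + 2 + i)).prod

/-- The four explicit permutations of `Ω`, indexed by `0, 1, 2, 3`. -/
def permString (n : ℕ) : Fin 4 → Equiv.Perm (Omega n) :=
  ![perm1 n, perm2 n, perm3 n, perm4 n]

/-! ### Reducing the intersection property to a few pairs of subgroups -/

section SubgroupOn

variable {G : Type*} [Group G] {r : ℕ} {t : Fin r → G}

/-! Realise `B_n` as the signed permutations {±1}^n ⋊ Sym(n), the points k and n + k of Ω being the
two signed versions of one index, with indices counted from 0. Then t₁, t₂, t₃ are pure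
permutations, and t₄ is (0 1) combined with the sign change at all indices ≥ 2. That the abstract
Coxeter group is no larger than this group follows from normal forms for cosets of parabolic
subgroups (`IsTypeBFamily.eq_one_of_map_eq_one`).

The product t₁t₂ is (0 1) times a cycle of odd length n - 2, so a power of it is a transposition,
and conjugates of that show that G_123 is all of Sym(n) (`eq_top_of_base_mem`). The facet G_234 is
the image of an embedding of {±1} × Sym(5) (`facetHom`): (ε, g) permutes the first five indices by
g, acts on the others by the involution (5 6)(7 8)⋯ exactly when ε · sgn g = -1, and, with p the
resulting permutation, carries the sign ε τ(i) τ(p⁻¹ i) at i, where τ is -1 on {1, 3, 4} and 1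
elsewhere.

An element of G_234 lies in G_123 when it has no signs. As {1, 3, 4} and its complement in the five
indices have different sizes, this forces ε = 1 and g to preserve {1, 3, 4}. The stabiliser Sym(3) ×
Sym(2) is dihedral of order 12 and equals G_23. Together with G_12 ∩ G_23 = G_2 and G_23 ∩ G_34 =
G_3 this gives the intersection property (`IsCString.of_four`).

Let n > 5 and let a nontrivial normal subgroup be factored out. If it contains an element with
nontrivial permutation part, it contains every double transposition, so t₃ dies. If it consists of
sign changes, some element of G_234 outside G_23 becomes a pure permutation, and G_123 ∩ G_234
grows: for the central element -1 this is the element above -1 ∈ {±1}, whose permutation part is (5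
6)(7 8)⋯; otherwise all even sign changes are in the kernel, and the element above (0 1) ∈ Sym(5)
serves. -/

theorem subgroupOn_mono (t : Fin r → G) {J K : Set (Fin r)} (h : J ⊆ K) :
    subgroupOn t J ≤ subgroupOn t K :=
  Subgroup.closure_mono (Set.image_mono h)

theorem mem_subgroupOn_of_forall {J K : Set (Fin r)} {g : G} (hg : g ∈ subgroupOn t J)
    (h : ∀ i ∈ J, i ∈ K) : g ∈ subgroupOn t K :=
  subgroupOn_mono t h hg

theorem mem_subgroupOn {J : Set (Fin r)} {i : Fin r} (hi : i ∈ J) : t i ∈ subgroupOn t J :=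
  Subgroup.subset_closure ⟨i, hi, rfl⟩

theorem subgroupOn_comp {H : Type*} [Group H] (f : G →* H) (t : Fin r → G) (J : Set (Fin r)) :
    subgroupOn (fun i => f (t i)) J = (subgroupOn t J).map f := by
  rw [subgroupOn, subgroupOn, MonoidHom.map_closure, Set.image_image]

/-- Commutation passes from the generators to the generated groups, so the products `x * y` already
form a subgroup. -/
theorem exists_mul_eq_of_mem_subgroupOn_union {J K : Set (Fin r)}
    (h : ∀ i ∈ J, ∀ k ∈ K, Commute (t i) (t k)) {g : G} (hg : g ∈ subgroupOn t (J ∪ K)) :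
    ∃ x ∈ subgroupOn t J, ∃ y ∈ subgroupOn t K, x * y = g := by
  have hle : subgroupOn t J ≤ Subgroup.centralizer (subgroupOn t K : Set G) := by
    rw [subgroupOn, subgroupOn, Subgroup.centralizer_closure, Subgroup.closure_le]
    rintro _ ⟨i, hi, rfl⟩
    rw [SetLike.mem_coe, Subgroup.mem_centralizer_iff]
    rintro _ ⟨k, hk, rfl⟩
    exact (h i hi k hk).symm
  induction hg using Subgroup.closure_induction with
  | mem x hx =>
    obtain ⟨i, hi | hi, rfl⟩ := hx
    · exact ⟨t i, mem_subgroupOn hi, 1, one_mem _, mul_one _⟩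
    · exact ⟨1, one_mem _, t i, mem_subgroupOn hi, one_mul _⟩
  | one => exact ⟨1, one_mem _, 1, one_mem _, mul_one _⟩
  | mul _ _ _ _ ih₁ ih₂ =>
    obtain ⟨x, hx, y, hy, rfl⟩ := ih₁
    obtain ⟨x', hx', y', hy', rfl⟩ := ih₂
    refine ⟨x * x', mul_mem hx hx', y * y', mul_mem hy hy', ?_⟩
    have := Subgroup.mem_centralizer_iff.1 (hle hx') y hy
    rw [mul_assoc, mul_assoc, ← mul_assoc x' y, ← this, mul_assoc]
  | inv _ _ ih =>
    obtain ⟨x, hx, y, hy, rfl⟩ := ih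
    refine ⟨x⁻¹, inv_mem hx, y⁻¹, inv_mem hy, ?_⟩
    rw [← mul_inv_rev, Subgroup.mem_centralizer_iff.1 (hle hx) y hy]

/-- The intersection property for the subsets of `I`. -/
def InterOn (t : Fin r → G) (I : Set (Fin r)) : Prop :=
  ∀ J ⊆ I, ∀ K ⊆ I, subgroupOn t J ⊓ subgroupOn t K = subgroupOn t (J ∩ K)

theorem interOn_iff_le {I : Set (Fin r)} :
    InterOn t I ↔ ∀ J ⊆ I, ∀ K ⊆ I,
      subgroupOn t J ⊓ subgroupOn t K ≤ subgroupOn t (J ∩ K) :=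
  forall₄_congr fun _ _ _ _ => ⟨le_of_eq, fun h => h.antisymm <|
    le_inf (subgroupOn_mono t Set.inter_subset_left) (subgroupOn_mono t Set.inter_subset_right)⟩

theorem interOn_singleton (t : Fin r → G) (a : Fin r) : InterOn t {a} := by
  refine interOn_iff_le.2 fun J hJ K hK => ?_
  rcases Set.subset_singleton_iff_eq.1 hJ with rfl | rfl
  · exact inf_le_left.trans (subgroupOn_mono t (by simp))
  · rcases Set.subset_singleton_iff_eq.1 hK with rfl | rfl
    · exact inf_le_right.trans (subgroupOn_mono t (by simp))
    · exact inf_le_left.trans (subgroupOn_mono t (by simp))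

section Interval

variable (hcomm : ∀ i j : Fin r, 2 ≤ |((i : ℕ) : ℤ) - ((j : ℕ) : ℤ)| → Commute (t i) (t j))
  {a b : Fin r} (hlo : InterOn t (Set.Ico a b)) (hhi : InterOn t (Set.Ioc a b))
  (hmid : subgroupOn t (Set.Ico a b) ⊓ subgroupOn t (Set.Ioc a b) ≤ subgroupOn t (Set.Ioo a b))

include hcomm in
-- Omitting an index cuts the string into two commuting pieces: indices on opposite sides of `m`
-- differ by at least 2.
theorem exists_mul_eq_of_notMem {J : Set (Fin r)} {m : Fin r} (hm : m ∉ J) {g : G}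
    (hg : g ∈ subgroupOn t J) :
    ∃ x ∈ subgroupOn t (J ∩ Set.Iio m), ∃ y ∈ subgroupOn t (J ∩ Set.Ioi m), x * y = g := by
  refine exists_mul_eq_of_mem_subgroupOn_union (fun i hi k hk => hcomm i k ?_)
    (subgroupOn_mono t (fun i hi => ?_) hg)
  · have h1 := Fin.lt_def.1 hi.2
    have h2 := Fin.lt_def.1 hk.2
    rw [abs_sub_comm]
    exact le_trans (by omega) (le_abs_self _)
  · rcases lt_trichotomy i m with h | h | h
    · exact Or.inl ⟨hi, h⟩
    · exact absurd (h ▸ hi) hm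
    · exact Or.inr ⟨hi, h⟩

include hhi hmid in
theorem inf_subgroupOn_Ico_le_of_subset {J : Set (Fin r)} (hJ : J ⊆ Set.Ioc a b) :
    subgroupOn t J ⊓ subgroupOn t (Set.Ico a b) ≤ subgroupOn t (J \ {b}) := by
  rintro g ⟨h1, h2⟩
  have h3 := hmid ⟨h2, subgroupOn_mono t hJ h1⟩
  have h4 : g ∈ subgroupOn t (J ∩ Set.Ioo a b) := by
    rw [← hhi J hJ _ Set.Ioo_subset_Ioc_self]
    exact ⟨h1, h3⟩
  exact mem_subgroupOn_of_forall h4 fun i hi => ⟨hi.1, hi.2.2.ne⟩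

include hlo hmid in
theorem inf_subgroupOn_Ioc_le_of_subset {J : Set (Fin r)} (hJ : J ⊆ Set.Ico a b) :
    subgroupOn t J ⊓ subgroupOn t (Set.Ioc a b) ≤ subgroupOn t (J \ {a}) := by
  rintro g ⟨h1, h2⟩
  have h3 := hmid ⟨subgroupOn_mono t hJ h1, h2⟩
  have h4 : g ∈ subgroupOn t (J ∩ Set.Ioo a b) := by
    rw [← hlo J hJ _ Set.Ioo_subset_Ico_self]
    exact ⟨h1, h3⟩
  exact mem_subgroupOn_of_forall h4 fun i hi => ⟨hi.1, hi.2.1.ne'⟩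

include hcomm hhi hmid in
-- For a missing index `m < b`, the factor of `g` below `m` already lies in the group of `Ico a b`
-- and cancels. The other factor uses indices in `Ioc a b` only, where
-- `inf_subgroupOn_Ico_le_of_subset` applies.
theorem inf_subgroupOn_Ico_le {J : Set (Fin r)} (hJ : J ⊂ Set.Icc a b) :
    subgroupOn t J ⊓ subgroupOn t (Set.Ico a b) ≤ subgroupOn t (J \ {b}) := by
  obtain ⟨m, hm, hmJ⟩ := Set.exists_of_ssubset hJ
  rcases hm.2.eq_or_lt with rfl | hmb
  · exact inf_le_left.trans (subgroupOn_mono t fun i hi => ⟨hi, fun h => hmJ (h ▸ hi)⟩)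
  rintro g ⟨h1, h2⟩
  obtain ⟨x, hx, y, hy, rfl⟩ := exists_mul_eq_of_notMem hcomm hmJ h1
  have hx' : x ∈ subgroupOn t (Set.Ico a b) :=
    mem_subgroupOn_of_forall hx fun i hi => ⟨(hJ.1 hi.1).1, lt_trans hi.2 hmb⟩
  have hy' := (Subgroup.mul_mem_cancel_left _ hx').1 h2
  refine mul_mem (mem_subgroupOn_of_forall hx fun i hi => ⟨hi.1, (lt_trans hi.2 hmb).ne⟩)
    (subgroupOn_mono t (Set.sdiff_subset_sdiff_left Set.inter_subset_left) <|
      inf_subgroupOn_Ico_le_of_subset hhi hmid (fun i hi => ?_) ⟨hy, hy'⟩)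
  exact ⟨lt_of_le_of_lt hm.1 hi.2, (hJ.1 hi.1).2⟩

include hcomm hlo hmid in
theorem inf_subgroupOn_Ioc_le {J : Set (Fin r)} (hJ : J ⊂ Set.Icc a b) :
    subgroupOn t J ⊓ subgroupOn t (Set.Ioc a b) ≤ subgroupOn t (J \ {a}) := by
  obtain ⟨m, hm, hmJ⟩ := Set.exists_of_ssubset hJ
  rcases hm.1.eq_or_lt with rfl | ham
  · exact inf_le_left.trans (subgroupOn_mono t fun i hi => ⟨hi, fun h => hmJ (h ▸ hi)⟩)
  rintro g ⟨h1, h2⟩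
  obtain ⟨x, hx, y, hy, rfl⟩ := exists_mul_eq_of_notMem hcomm hmJ h1
  have hy' : y ∈ subgroupOn t (Set.Ioc a b) :=
    mem_subgroupOn_of_forall hy fun i hi => ⟨lt_trans ham hi.2, (hJ.1 hi.1).2⟩
  have hx' := (Subgroup.mul_mem_cancel_right _ hy').1 h2
  refine mul_mem (subgroupOn_mono t (Set.sdiff_subset_sdiff_left Set.inter_subset_left) <|
      inf_subgroupOn_Ioc_le_of_subset hlo hmid (fun i hi => ?_) ⟨hx, hx'⟩)
    (mem_subgroupOn_of_forall hy fun i hi => ⟨hi.1, (lt_trans ham hi.2).ne'⟩)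
  exact ⟨(hJ.1 hi.1).1, lt_of_lt_of_le hi.2 hm.2⟩

include hcomm hlo hhi hmid in
/-- The intersection property on an interval follows from the one on the two maximal
subintervals, except possibly for two proper subsets which both contain both endpoints. -/
theorem inf_subgroupOn_le_of_Icc {J K : Set (Fin r)} (hJ : J ⊆ Set.Icc a b)
    (hK : K ⊆ Set.Icc a b) (h : a ∉ J ∨ b ∉ J) :
    subgroupOn t J ⊓ subgroupOn t K ≤ subgroupOn t (J ∩ K) := by
  rcases hK.eq_or_ssubset with rfl | hK
  · exact inf_le_left.trans (subgroupOn_mono t fun i hi => ⟨hi, hJ hi⟩)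
  rintro g ⟨h1, h2⟩
  rcases h with h | h
  · have hJ' : J ⊆ Set.Ioc a b := fun i hi =>
      ⟨lt_of_le_of_ne (hJ hi).1 fun e => h (e ▸ hi), (hJ hi).2⟩
    have h3 := inf_subgroupOn_Ioc_le hcomm hlo hmid hK ⟨h2, subgroupOn_mono t hJ' h1⟩
    have h4 : g ∈ subgroupOn t (J ∩ (K \ {a})) := by
      rw [← hhi J hJ' _ fun i hi => ⟨lt_of_le_of_ne (hK.1 hi.1).1 (Ne.symm hi.2), (hK.1 hi.1).2⟩]
      exact ⟨h1, h3⟩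
    exact subgroupOn_mono t (Set.inter_subset_inter_right _ Set.sdiff_subset) h4
  · have hJ' : J ⊆ Set.Ico a b := fun i hi =>
      ⟨(hJ hi).1, lt_of_le_of_ne (hJ hi).2 fun e => h (e ▸ hi)⟩
    have h3 := inf_subgroupOn_Ico_le hcomm hhi hmid hK ⟨h2, subgroupOn_mono t hJ' h1⟩
    have h4 : g ∈ subgroupOn t (J ∩ (K \ {b})) := by
      rw [← hlo J hJ' _ fun i hi => ⟨(hK.1 hi.1).1, lt_of_le_of_ne (hK.1 hi.1).2 hi.2⟩]
      exact ⟨h1, h3⟩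
    exact subgroupOn_mono t (Set.inter_subset_inter_right _ Set.sdiff_subset) h4

include hcomm hlo hhi hmid in
theorem interOn_Icc (hends : ∀ J ⊂ Set.Icc a b, ∀ K ⊂ Set.Icc a b, a ∈ J → b ∈ J → a ∈ K → b ∈ K →
    subgroupOn t J ⊓ subgroupOn t K ≤ subgroupOn t (J ∩ K)) : InterOn t (Set.Icc a b) := by
  refine interOn_iff_le.2 fun J hJ K hK => ?_
  by_cases h1 : a ∈ J ∧ b ∈ J
  · by_cases h2 : a ∈ K ∧ b ∈ K
    · rcases hJ.eq_or_ssubset with rfl | hJ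
      · exact inf_le_right.trans (subgroupOn_mono t fun i hi => ⟨hK hi, hi⟩)
      rcases hK.eq_or_ssubset with rfl | hK
      · exact inf_le_left.trans (subgroupOn_mono t fun i hi => ⟨hi, hJ.1 hi⟩)
      exact hends J hJ K hK h1.1 h1.2 h2.1 h2.2
    · rw [inf_comm, Set.inter_comm]
      exact inf_subgroupOn_le_of_Icc hcomm hlo hhi hmid hK hJ (not_and_or.1 h2)
  · exact inf_subgroupOn_le_of_Icc hcomm hlo hhi hmid hJ hK (not_and_or.1 h1)

end Interval

theorem subgroupOn_singleton_inf_le {i j : Fin r} (hi : orderOf (t i) = 2)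
    (hj : orderOf (t j) = 2) (hij : t i ≠ t j) (I : Set (Fin r)) :
    subgroupOn t {i} ⊓ subgroupOn t {j} ≤ subgroupOn t I := by
  have key : ∀ k, orderOf (t k) = 2 → ∀ g ∈ subgroupOn t {k}, g = 1 ∨ g = t k := by
    intro k hk g hg
    rw [subgroupOn, Set.image_singleton, ← Subgroup.zpowers_eq_closure] at hg
    obtain ⟨m, rfl⟩ := hg
    have h2 : t k ^ (2 : ℤ) = 1 := by exact_mod_cast hk ▸ pow_orderOf_eq_one (t k)
    rcases Int.even_or_odd' m with ⟨c, rfl | rfl⟩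
    · left; simp only [zpow_mul, h2, one_zpow]
    · right; simp only [zpow_add, zpow_mul, h2, one_zpow, one_mul, zpow_one]
  rintro g ⟨h1, h2⟩
  rcases key i hi g h1 with rfl | rfl
  · exact one_mem _
  · rcases key j hj _ h2 with h | h
    · rw [h]; exact one_mem _
    · exact absurd h hij

end SubgroupOn

/-- A criterion for strings of length four to be C-strings. -/
theorem IsCString.of_four {G : Type*} [Group G] {t : Fin 4 → G} (hinv : ∀ i, orderOf (t i) = 2)
    (hgen : Subgroup.closure (Set.range t) = ⊤)
    (hcomm : ∀ i j : Fin 4, 2 ≤ |((i : ℕ) : ℤ) - ((j : ℕ) : ℤ)| → Commute (t i) (t j))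
    (h01 : t 0 ≠ t 1) (h12 : t 1 ≠ t 2) (h23 : t 2 ≠ t 3)
    (hlo : subgroupOn t {0, 1} ⊓ subgroupOn t {1, 2} ≤ subgroupOn t {1})
    (hhi : subgroupOn t {1, 2} ⊓ subgroupOn t {2, 3} ≤ subgroupOn t {2})
    (hmid : subgroupOn t {0, 1, 2} ⊓ subgroupOn t {1, 2, 3} ≤ subgroupOn t {1, 2}) :
    IsCString t := by
  have hsets : ∀ i j : Fin 4, i < j → j ≤ i + 1 → i ≠ 3 →
      Set.Ico i j = {i} ∧ Set.Ioc i j = {j} := by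
    intro i j
    fin_cases i <;> fin_cases j <;> simp [Set.ext_iff, Fin.forall_fin_succ]
  have pair : ∀ i j : Fin 4, i < j → j ≤ i + 1 → i ≠ 3 → t i ≠ t j → InterOn t (Set.Icc i j) := by
    intro i j hij hij' hi hne
    obtain ⟨h1, h2⟩ := hsets i j hij hij' hi
    refine interOn_Icc hcomm (h1 ▸ interOn_singleton t i) (h2 ▸ interOn_singleton t j) ?_ ?_
    · rw [h1, h2]
      exact subgroupOn_singleton_inf_le (hinv i) (hinv j) hne _
    · intro J hJ K hK hiJ hjJ _ _
      refine absurd ?_ hJ.2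
      intro k hk
      rcases hk.1.eq_or_lt with rfl | hlt
      · exact hiJ
      · have : k ∈ Set.Ioc i j := ⟨hlt, hk.2⟩
        rw [h2] at this
        exact this ▸ hjJ
  have triple : ∀ i j k : Fin 4, Set.Icc i k = {i, j, k} → Set.Ico i k = Set.Icc i j →
      Set.Ioc i k = Set.Icc j k → Set.Icc i j = {i, j} → Set.Icc j k = {j, k} →
      Set.Ioo i k = {j} → InterOn t (Set.Icc i j) → InterOn t (Set.Icc j k) →
      subgroupOn t {i, j} ⊓ subgroupOn t {j, k} ≤ subgroupOn t {j} → InterOn t (Set.Icc i k) := by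
    intro i j k e1 e2 e3 e4 e5 e6 hij hjk h
    refine interOn_Icc hcomm (e2 ▸ hij) (e3 ▸ hjk) ?_ ?_
    · rw [e2, e3, e4, e5, e6]; exact h
    -- A proper subset of `{i, j, k}` containing both ends is `{i, k}`, hence lies in `K`.
    · intro J hJ K hK hiJ hkJ hiK hkK
      refine inf_le_left.trans (subgroupOn_mono t fun l hl => ⟨hl, ?_⟩)
      have hl' := hJ.1 hl
      rw [e1] at hl' hJ
      rcases hl' with rfl | rfl | rfl
      · exact hiK
      · refine absurd ?_ hJ.2
        rintro _ (rfl | rfl | rfl) <;> assumption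
      · exact hkK
  have t1 : InterOn t (Set.Icc 0 2) := triple 0 1 2
    (by simp [Set.ext_iff, Fin.forall_fin_succ]) (by simp [Set.ext_iff, Fin.forall_fin_succ])
    (by simp [Set.ext_iff, Fin.forall_fin_succ]) (by simp [Set.ext_iff, Fin.forall_fin_succ])
    (by simp [Set.ext_iff, Fin.forall_fin_succ]) (by simp [Set.ext_iff, Fin.forall_fin_succ])
    (pair 0 1 (by decide) (by decide) (by decide) h01)
    (pair 1 2 (by decide) (by decide) (by decide) h12) hlo
  have t2 : InterOn t (Set.Icc 1 3) := triple 1 2 3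
    (by simp [Set.ext_iff, Fin.forall_fin_succ]) (by simp [Set.ext_iff, Fin.forall_fin_succ])
    (by simp [Set.ext_iff, Fin.forall_fin_succ]) (by simp [Set.ext_iff, Fin.forall_fin_succ])
    (by simp [Set.ext_iff, Fin.forall_fin_succ]) (by simp [Set.ext_iff, Fin.forall_fin_succ])
    (pair 1 2 (by decide) (by decide) (by decide) h12)
    (pair 2 3 (by decide) (by decide) (by decide) h23) hhi
  have e1 : Set.Ico (0 : Fin 4) 3 = Set.Icc 0 2 := by simp [Set.ext_iff, Fin.forall_fin_succ]
  have e2 : Set.Ioc (0 : Fin 4) 3 = Set.Icc 1 3 := by simp [Set.ext_iff, Fin.forall_fin_succ]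
  have e3 : Set.Icc (0 : Fin 4) 2 = {0, 1, 2} := by simp [Set.ext_iff, Fin.forall_fin_succ]
  have e4 : Set.Icc (1 : Fin 4) 3 = {1, 2, 3} := by simp [Set.ext_iff, Fin.forall_fin_succ]
  have e5 : Set.Ioo (0 : Fin 4) 3 = {1, 2} := by simp [Set.ext_iff, Fin.forall_fin_succ]
  have e6 : Set.Icc (0 : Fin 4) 3 = Set.univ := by simp [Set.ext_iff, Fin.forall_fin_succ]
  have hmid' : subgroupOn t (Set.Ico 0 3) ⊓ subgroupOn t (Set.Ioc 0 3) ≤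
      subgroupOn t (Set.Ioo 0 3) := by
    rw [e1, e2, e3, e4, e5]; exact hmid
  have low := @inf_subgroupOn_le_of_Icc _ _ _ t hcomm 0 3 (e1 ▸ t1) (e2 ▸ t2) hmid'
  -- With `2 ∉ J` the element is a product of one over the indices below 2 and one over `{3}`. As `3
  -- ∈ K` the second factor cancels, and the first involves a set without 3, to which `low` applies.
  have ends : ∀ J K : Set (Fin 4), 3 ∈ J → 3 ∈ K → 2 ∉ J →
      subgroupOn t J ⊓ subgroupOn t K ≤ subgroupOn t (J ∩ K) := by
    rintro J K hJ hK h2 g ⟨hg1, hg2⟩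
    obtain ⟨x, hx, y, hy, rfl⟩ := exists_mul_eq_of_notMem hcomm h2 hg1
    have hJ3 : J ∩ Set.Ioi 2 ⊆ {3} := by
      rintro i ⟨-, hi⟩
      rw [Set.mem_Ioi, Fin.lt_def] at hi
      exact Fin.ext (by have := i.2; simp at hi ⊢; omega)
    have hx' := (Subgroup.mul_mem_cancel_right _
      (subgroupOn_mono t (hJ3.trans (Set.singleton_subset_iff.2 hK)) hy)).1 hg2
    have hx2 := low (J := J ∩ Set.Iio 2) (K := K) (e6 ▸ Set.subset_univ _) (e6 ▸ Set.subset_univ _)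
      (Or.inr fun h => absurd h.2 (by decide)) ⟨hx, hx'⟩
    exact mul_mem (mem_subgroupOn_of_forall hx2 fun i hi => ⟨hi.1.1, hi.2⟩)
      (mem_subgroupOn_of_forall hy fun i hi => (hJ3 hi : i = 3) ▸ ⟨hJ, hK⟩)
  have full : InterOn t (Set.Icc 0 3) := by
    refine interOn_Icc hcomm (e1 ▸ t1) (e2 ▸ t2) hmid' ?_
    intro J hJ K hK h0J h3J h0K h3K
    by_cases h2J : 2 ∈ J
    · by_cases h2K : 2 ∈ K
      -- A proper `J` containing 0, 2 and 3 misses 1, so it is contained in `K`.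
      · have h1J : 1 ∉ J := fun h1J => hJ.2 <| by
          rw [e6]
          rintro i -
          fin_cases i <;> assumption
        refine inf_le_left.trans (subgroupOn_mono t fun i hi => ⟨hi, ?_⟩)
        fin_cases i
        · exact h0K
        · exact absurd hi h1J
        · exact h2K
        · exact h3K
      · rw [inf_comm, Set.inter_comm]
        exact ends K J h3K h3J h2K
    · exact ends J K h3J h3K h2J
  exact ⟨hinv, hgen, hcomm, fun J K => full J (e6 ▸ Set.subset_univ _) K (e6 ▸ Set.subset_univ _)⟩

theorem IsCString.map {G H : Type*} [Group G] [Group H] {r : ℕ} {t : Fin r → G} (h : IsCString t)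
    (e : G ≃* H) : IsCString fun i => e (t i) where
  involution i := by rw [MulEquiv.orderOf_eq]; exact h.involution i
  generates := by
    have := congrArg (Subgroup.map e.toMonoidHom) h.generates
    rw [MonoidHom.map_closure, ← Set.range_comp, Subgroup.map_top_of_surjective _ e.surjective]
      at this
    exact this
  commute i j hij := (h.commute i j hij).map e
  inter J K := by
    have := congrArg (Subgroup.map e.toMonoidHom) (h.inter J K)
    rw [Subgroup.map_inf _ _ _ e.injective] at this
    simp only [← subgroupOn_comp] at this
    exact this

/-! ### Coset normal forms from the Coxeter relations of type B -/

/-- Elements `s 0, …, s (n - 1)` of a group satisfying the Coxeter relations of type `B n`, the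
quadruple bond being the last one. -/
structure IsTypeBFamily {W : Type*} [Group W] (n : ℕ) (s : ℕ → W) : Prop where
  sq : ∀ i < n, s i * s i = 1
  comm : ∀ i j, i + 1 < j → j < n → s i * s j = s j * s i
  braid : ∀ i, i + 2 < n → s i * s (i + 1) * s i = s (i + 1) * s i * s (i + 1)
  braid_four : ∀ i, i + 2 = n →
    s i * s (i + 1) * s i * s (i + 1) = s (i + 1) * s i * s (i + 1) * s i

/-- The product `s k * s (k + 1) * ⋯` of `m` factors. -/
def ascend {W : Type*} [Group W] (s : ℕ → W) (k : ℕ) : ℕ → W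
  | 0 => 1
  | m + 1 => ascend s k m * s (k + m)

/-- The product `s e * s (e - 1) * ⋯` of `m` factors. -/
def descend {W : Type*} [Group W] (s : ℕ → W) (e : ℕ) : ℕ → W
  | 0 => 1
  | m + 1 => descend s e m * s (e - m)

namespace IsTypeBFamily

variable {W : Type*} [Group W] {n : ℕ} {s : ℕ → W} (h : IsTypeBFamily n s)

include h

theorem inv_eq {i : ℕ} (hi : i < n) : (s i)⁻¹ = s i := inv_eq_of_mul_eq_one_left (h.sq i hi)

theorem ascend_mul_of_lt {k m i : ℕ} (h1 : k + m < i) (h2 : i < n) :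
    ascend s k m * s i = s i * ascend s k m := by
  induction m with
  | zero => simp [ascend]
  | succ m ih =>
    rw [ascend, mul_assoc, h.comm (k + m) i (by omega) h2, ← mul_assoc, ih (by omega), mul_assoc]

/-- The letter `s i` moves left past the later letters up to `s i * s (i + 1)`. There the braid
relation turns it into `s (i + 1)`, which commutes with all earlier letters. -/
theorem ascend_mul_of_gt {k m i : ℕ} (h1 : k ≤ i) (h2 : i + 1 < k + m) (h3 : k + m ≤ n)
    (h4 : i + 2 < n) : ascend s k m * s i = s (i + 1) * ascend s k m := by
  induction m with
  | zero => omega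
  | succ m ih =>
    rcases Nat.lt_or_ge (i + 1) (k + m) with h5 | h5
    · rw [ascend, mul_assoc, ← h.comm i (k + m) h5 (by omega), ← mul_assoc, ih h5 (by omega),
        mul_assoc]
    · obtain ⟨l, rfl⟩ : ∃ l, m = l + 1 := ⟨m - 1, by omega⟩
      obtain rfl : i = k + l := by omega
      have e : k + (l + 1) = k + l + 1 := by omega
      rw [ascend, ascend, e]
      calc ascend s k l * s (k + l) * s (k + l + 1) * s (k + l)
          = ascend s k l * (s (k + l) * s (k + l + 1) * s (k + l)) := by simp only [mul_assoc]
        _ = ascend s k l * s (k + l + 1) * s (k + l) * s (k + l + 1) := by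
          rw [h.braid _ h4]; simp only [mul_assoc]
        _ = _ := by
          rw [h.ascend_mul_of_lt (by omega) (by omega)]; simp only [mul_assoc]

theorem descend_mul_of_lt {e m i : ℕ} (h1 : i + m < e) (h2 : e < n) :
    descend s e m * s i = s i * descend s e m := by
  induction m with
  | zero => simp [descend]
  | succ m ih =>
    rw [descend, mul_assoc, ← h.comm i (e - m) (by omega) (by omega), ← mul_assoc,
      ih (by omega), mul_assoc]

theorem descend_mul_of_gt {e m i : ℕ} (h1 : i + 1 ≤ e) (h2 : e < i + m) (h3 : m ≤ e + 1)
    (h4 : e + 1 < n) : descend s e m * s (i + 1) = s i * descend s e m := by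
  induction m with
  | zero => omega
  | succ m ih =>
    rcases Nat.lt_or_ge e (i + m) with h5 | h5
    · rw [descend, mul_assoc, h.comm (e - m) (i + 1) (by omega) (by omega), ← mul_assoc,
        ih h5 (by omega), mul_assoc]
    · obtain ⟨l, rfl⟩ : ∃ l, m = l + 1 := ⟨m - 1, by omega⟩
      have e1 : e - l = i + 1 := by omega
      have e2 : e - (l + 1) = i := by omega
      rw [descend, descend, e1, e2]
      calc descend s e l * s (i + 1) * s i * s (i + 1)
          = descend s e l * (s (i + 1) * s i * s (i + 1)) := by simp only [mul_assoc]
        _ = descend s e l * s i * s (i + 1) * s i := by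
          rw [← h.braid i (by omega)]; simp only [mul_assoc]
        _ = _ := by
          rw [h.descend_mul_of_lt (by omega) (by omega)]; simp only [mul_assoc]

/-- The quadruple relation applies at the turning point `s e * s (e + 1) * s e`; all letters further
from it commute with `s (e + 1)`. -/
theorem ascend_mul_descend_mul_last {k e m : ℕ} (h1 : k ≤ e) (h2 : e + 2 = n) (h3 : m ≤ e) :
    ascend s k (n - k) * descend s e (m + 1) * s (e + 1) =
      s (e + 1) * (ascend s k (n - k) * descend s e (m + 1)) := by
  induction m with
  | zero =>
    obtain ⟨l, hl⟩ : ∃ l, n - k = l + 1 + 1 := ⟨n - k - 2, by omega⟩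
    have e1 : k + l = e := by omega
    have e2 : k + (l + 1) = e + 1 := by omega
    rw [hl, ascend, ascend, e1, e2]
    simp only [descend, one_mul, Nat.sub_zero]
    calc ascend s k l * s e * s (e + 1) * s e * s (e + 1)
        = ascend s k l * (s e * s (e + 1) * s e * s (e + 1)) := by simp only [mul_assoc]
      _ = ascend s k l * s (e + 1) * s e * s (e + 1) * s e := by
        rw [h.braid_four e h2]; simp only [mul_assoc]
      _ = _ := by
        rw [h.ascend_mul_of_lt (by omega) (by omega)]; simp only [mul_assoc]
  | succ m ih =>
    have e1 := h.comm (e - (m + 1)) (e + 1) (by omega) (by omega)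
    rw [descend, ← mul_assoc, mul_assoc, e1, ← mul_assoc, ih (by omega), mul_assoc]

/-- Representatives of the cosets of the parabolic subgroup obtained by deleting the first
generator. -/
theorem exists_coset_rep {k : ℕ} (hk : k < n) {w : W}
    (hw : w ∈ Subgroup.closure (s '' Set.Ico k n)) :
    ∃ w' ∈ Subgroup.closure (s '' Set.Ico (k + 1) n), ∃ m,
      (m ≤ n - k ∧ w = w' * ascend s k m) ∨
      (m < n - k ∧ w = w' * (ascend s k (n - k) * descend s (n - 2) m)) := by
  have gen : ∀ {i}, k < i → i < n → s i ∈ Subgroup.closure (s '' Set.Ico (k + 1) n) :=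
    fun h1 h2 => Subgroup.subset_closure ⟨_, ⟨h1, h2⟩, rfl⟩
  -- The representatives are the proper and improper initial segments of the word `s k ⋯ s (n - 1) s
  -- (n - 2) ⋯ s k`, 2(n - k) of them. Right multiplication by a generator lengthens or shortens the
  -- segment by one letter, or passes through it and emerges on the left as a generator of index
  -- above `k`. If `n = 1`, the truncated `n - 2` is harmless because then `m = 0`.
  have step : ∀ x : W, (∃ w' ∈ Subgroup.closure (s '' Set.Ico (k + 1) n), ∃ m,
      (m ≤ n - k ∧ x = w' * ascend s k m) ∨
      (m < n - k ∧ x = w' * (ascend s k (n - k) * descend s (n - 2) m))) →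
      ∀ i, k ≤ i → i < n → ∃ w' ∈ Subgroup.closure (s '' Set.Ico (k + 1) n), ∃ m,
      (m ≤ n - k ∧ x * s i = w' * ascend s k m) ∨
      (m < n - k ∧ x * s i = w' * (ascend s k (n - k) * descend s (n - 2) m)) := by
    rintro _ ⟨w', hw', m, ⟨hm, rfl⟩ | ⟨hm, rfl⟩⟩ i hki hin
    · rcases lt_trichotomy i (k + m) with h1 | rfl | h1
      · rcases Nat.lt_or_ge (i + 1) (k + m) with h2 | h2
        · rcases Nat.lt_or_ge (i + 2) n with h3 | h3
          · refine ⟨w' * s (i + 1), mul_mem hw' (gen (by omega) (by omega)), m, Or.inl ⟨hm, ?_⟩⟩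
            rw [mul_assoc, h.ascend_mul_of_gt hki h2 (by omega) h3, mul_assoc]
          · refine ⟨w', hw', 1, Or.inr ⟨by omega, ?_⟩⟩
            obtain rfl : m = n - k := by omega
            obtain rfl : i = n - 2 := by omega
            simp [descend, mul_assoc]
        · obtain ⟨l, rfl⟩ : ∃ l, m = l + 1 := ⟨m - 1, by omega⟩
          obtain rfl : i = k + l := by omega
          refine ⟨w', hw', l, Or.inl ⟨by omega, ?_⟩⟩
          rw [ascend, mul_assoc, mul_assoc, h.sq _ hin, mul_one]
      · exact ⟨w', hw', m + 1, Or.inl ⟨by omega, by rw [ascend, mul_assoc]⟩⟩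
      · refine ⟨w' * s i, mul_mem hw' (gen (by omega) hin), m, Or.inl ⟨hm, ?_⟩⟩
        rw [mul_assoc, h.ascend_mul_of_lt h1 hin, mul_assoc]
    · rcases Nat.eq_zero_or_pos m with rfl | hm0
      · rcases Nat.lt_or_ge (i + 1) n with h1 | h1
        · rcases Nat.lt_or_ge (i + 2) n with h3 | h3
          · refine ⟨w' * s (i + 1), mul_mem hw' (gen (by omega) h1), 0, Or.inr ⟨hm, ?_⟩⟩
            simp only [descend, mul_one]
            rw [mul_assoc, h.ascend_mul_of_gt hki (by omega) (by omega) h3, mul_assoc]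
          · refine ⟨w', hw', 1, Or.inr ⟨by omega, ?_⟩⟩
            obtain rfl : i = n - 2 := by omega
            simp [descend, mul_assoc]
        · refine ⟨w', hw', n - k - 1, Or.inl ⟨by omega, ?_⟩⟩
          obtain ⟨l, hl⟩ : ∃ l, n - k = l + 1 := ⟨n - k - 1, by omega⟩
          have e : k + l = i := by omega
          rw [hl, descend, ascend, mul_one, mul_assoc, mul_assoc, e, h.sq _ hin, mul_one,
            Nat.add_sub_cancel]
      · rcases lt_trichotomy (i + m + 2) n with h1 | h1 | h1
        · refine ⟨w' * s (i + 1), mul_mem hw' (gen (by omega) (by omega)), m, Or.inr ⟨hm, ?_⟩⟩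
          rw [mul_assoc, mul_assoc, h.descend_mul_of_lt (by omega) (by omega), ← mul_assoc (ascend _ _ _),
            h.ascend_mul_of_gt hki (by omega) (by omega) (by omega)]
          simp only [mul_assoc]
        · refine ⟨w', hw', m + 1, Or.inr ⟨by omega, ?_⟩⟩
          have e : n - 2 - m = i := by omega
          rw [descend, e]
          simp only [mul_assoc]
        · rcases Nat.lt_or_ge (i + m + 1) n with h2 | h2
          · omega
          · rcases h2.eq_or_lt with h2 | h2
            · obtain ⟨l, rfl⟩ : ∃ l, m = l + 1 := ⟨m - 1, by omega⟩
              refine ⟨w', hw', l, Or.inr ⟨by omega, ?_⟩⟩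
              have e : n - 2 - l = i := by omega
              rw [descend, e, mul_assoc, mul_assoc, mul_assoc, h.sq _ hin, mul_one]
            · rcases Nat.lt_or_ge (i + 1) n with h3 | h3
              · obtain ⟨j, rfl⟩ : ∃ j, i = j + 1 := ⟨i - 1, by omega⟩
                refine ⟨w' * s (j + 1), mul_mem hw' (gen (by omega) hin), m, Or.inr ⟨hm, ?_⟩⟩
                rw [mul_assoc, mul_assoc, h.descend_mul_of_gt (by omega) (by omega) (by omega)
                  (by omega), ← mul_assoc (ascend _ _ _),
                  h.ascend_mul_of_gt (by omega) (by omega) (by omega) (by omega)]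
                simp only [mul_assoc]
              · obtain ⟨l, rfl⟩ : ∃ l, m = l + 1 := ⟨m - 1, by omega⟩
                have e : i = n - 2 + 1 := by omega
                refine ⟨w' * s i, mul_mem hw' (gen (by omega) hin), l + 1, Or.inr ⟨hm, ?_⟩⟩
                rw [mul_assoc, e, h.ascend_mul_descend_mul_last (by omega) (by omega) (by omega),
                  mul_assoc]
  induction hw using Subgroup.closure_induction_right with
  | one => exact ⟨1, one_mem _, 0, Or.inl ⟨by omega, by simp [ascend]⟩⟩
  | mul_right x y hx hy ih =>
    obtain ⟨i, hi, rfl⟩ := hy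
    exact step x ih i hi.1 hi.2
  | mul_inv_cancel x y hx hy ih =>
    obtain ⟨i, hi, rfl⟩ := hy
    rw [h.inv_eq hi.2]
    exact step x ih i hi.1 hi.2

/-- An action under which a type `B` family behaves as the simple reflections do on the vectors
`± e i` is faithful. -/
theorem eq_one_of_map_eq_one {X : Type*} (f : W →* Equiv.Perm X) (x y : ℕ → X)
    (hx : ∀ i, i + 1 < n → f (s i) (x i) = x (i + 1))
    (hfix : ∀ k i, k < i → i < n → f (s i) (x k) = x k)
    (hlast : ∀ i, i + 1 = n → f (s i) (x i) = y i)
    (hy : ∀ i, i + 1 < n → f (s i) (y (i + 1)) = y i)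
    (hxx : ∀ i j, i < j → j < n → x i ≠ x j) (hxy : ∀ i j, i < n → j < n → x i ≠ y j)
    {w : W} (hw : w ∈ Subgroup.closure (s '' Set.Ico 0 n)) (hw1 : f w = 1) : w = 1 := by
  have inv : ∀ i < n, ∀ z, (f (s i))⁻¹ z = f (s i) z := fun i hi z => by
    rw [← map_inv, h.inv_eq hi]
  have asc : ∀ k m, k + m < n → (f (ascend s k m))⁻¹ (x k) = x (k + m) := by
    intro k m
    induction m with
    | zero => simp [ascend]
    | succ m ih =>
      intro hm
      rw [ascend, map_mul, mul_inv_rev, Equiv.Perm.mul_apply, ih (by omega),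
        inv _ (by omega), hx _ (by omega)]
      rfl
  have asc_last : ∀ k, k < n → (f (ascend s k (n - k)))⁻¹ (x k) = y (n - 1) := by
    intro k hk
    obtain ⟨l, hl⟩ : ∃ l, n - k = l + 1 := ⟨n - k - 1, by omega⟩
    have e : k + l = n - 1 := by omega
    rw [hl, ascend, map_mul, mul_inv_rev, Equiv.Perm.mul_apply, asc k l (by omega), e,
      inv _ (by omega), hlast _ (by omega)]
  have desc : ∀ m, m < n → (f (descend s (n - 2) m))⁻¹ (y (n - 1)) = y (n - 1 - m) := by
    intro m
    induction m with
    | zero => simp [descend]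
    | succ m ih =>
      intro hm
      have e : n - 1 - m = n - 2 - m + 1 := by omega
      rw [descend, map_mul, mul_inv_rev, Equiv.Perm.mul_apply, ih (by omega),
        inv _ (by omega), e, hy _ (by omega)]
      congr 1
      omega
  have par : ∀ k, ∀ w' ∈ Subgroup.closure (s '' Set.Ico (k + 1) n), f w' (x k) = x k := by
    intro k w' hw'
    induction hw' using Subgroup.closure_induction with
    | mem z hz =>
      obtain ⟨i, hi, rfl⟩ := hz
      exact hfix k i hi.1 hi.2
    | one => simp
    | mul a b _ _ iha ihb => rw [map_mul, Equiv.Perm.mul_apply, ihb, iha]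
    | inv a _ iha => rw [map_inv, Equiv.Perm.inv_eq_iff_eq, iha]
  have fixed : ∀ k, ∀ w' ∈ Subgroup.closure (s '' Set.Ico (k + 1) n), ∀ r, w = w' * r →
      (f r)⁻¹ (x k) = x k := by
    intro k w' hw' r e
    have h1 : f w' * f r = 1 := by rw [← map_mul, ← e, hw1]
    rw [inv_eq_of_mul_eq_one_left h1]
    exact par k w' hw'
  -- The inverse of a nontrivial representative moves `x k` to another `x j` or to some `y j`, so a
  -- `w` acting trivially lies in the trivial coset, that is, in the next smaller parabolic
  -- subgroup. At `k = n` that subgroup is trivial.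
  have down : ∀ k ≤ n, w ∈ Subgroup.closure (s '' Set.Ico k n) := by
    intro k
    induction k with
    | zero => exact fun _ => hw
    | succ k ih =>
      intro hk
      obtain ⟨w', hw', m, ⟨hm, e⟩ | ⟨hm, e⟩⟩ := h.exists_coset_rep (by omega) (ih (by omega))
      · have hr := fixed k w' hw' _ e
        rcases Nat.eq_zero_or_pos m with rfl | hm0
        · rw [e, ascend, mul_one]; exact hw'
        rcases hm.eq_or_lt with rfl | hm
        · rw [asc_last k (by omega)] at hr
          exact absurd hr.symm (hxy _ _ (by omega) (by omega))
        · rw [asc k m (by omega)] at hr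
          exact absurd hr.symm (hxx _ _ (by omega) (by omega))
      · have hr := fixed k w' hw' _ e
        rw [map_mul, mul_inv_rev, Equiv.Perm.mul_apply, asc_last k (by omega),
          desc m (by omega)] at hr
        exact absurd hr.symm (hxy _ _ (by omega) (by omega))
  have := down n le_rfl
  simpa using this

end IsTypeBFamily

/-! ### Signed permutations and their simple reflections -/

/-- The group of signed permutations of `α`. -/
abbrev SignedPerm (α : Type*) : Type _ :=
  (α → ℤˣ) ⋊[mulAutArrow (G := Equiv.Perm α) (A := α) (M := ℤˣ)] Equiv.Perm α

namespace SignedPerm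

open SemidirectProduct Equiv

variable {α : Type*}

@[simp]
theorem arrow_apply (g : Perm α) (a : α → ℤˣ) (i : α) :
    (mulAutArrow (M := ℤˣ) g) a i = a (g⁻¹ i) := rfl

theorem mul_left_apply (x y : SignedPerm α) (i : α) :
    (x * y).left i = x.left i * y.left (x.right⁻¹ i) := rfl

theorem conj_inl (g : Perm α) (a : α → ℤˣ) :
    (inr g * inl a * (inr g)⁻¹ : SignedPerm α) = inl fun i => a (g⁻¹ i) := by
  rw [← map_inv, ← inl_aut]
  rfl

/-- The action of a signed permutation on the signed points. -/
def toPerm : SignedPerm α →* Perm (α × ℤˣ) where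
  toFun x :=
    { toFun := fun p => (x.right p.1, x.left (x.right p.1) * p.2)
      invFun := fun p => (x.right⁻¹ p.1, x.left p.1 * p.2)
      left_inv := fun p => by
        ext1
        · simp
        · simp only [← mul_assoc, Int.units_mul_self, one_mul]
      right_inv := fun p => by
        ext1
        · simp
        · simp [← mul_assoc, Int.units_mul_self] }
  map_one' := by ext p <;> simp
  map_mul' x y := by
    ext1 p
    simp [mul_left_apply, mul_assoc]

theorem toPerm_apply (x : SignedPerm α) (p : α × ℤˣ) :
    toPerm x p = (x.right p.1, x.left (x.right p.1) * p.2) := rfl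

theorem toPerm_injective : Function.Injective (toPerm (α := α)) := by
  refine (injective_iff_map_eq_one _).2 fun x hx => ?_
  have h : ∀ i, x.right i = i ∧ x.left (x.right i) = 1 := fun i => by
    have := congrArg (fun g => g (i, 1)) hx
    simpa [toPerm_apply] using this
  ext i
  · have := h i
    rw [this.1] at this
    simp [this.2]
  · simp [(h i).1]

variable [DecidableEq α]

theorem conj_inl_mulSingle (g : Perm α) (i : α) (e : ℤˣ) :
    (inr g * inl (Pi.mulSingle i e) * (inr g)⁻¹ : SignedPerm α) =
      inl (Pi.mulSingle (g i) e) := by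
  rw [conj_inl]
  congr 1
  funext j
  simp only [Pi.mulSingle_apply, Perm.inv_eq_iff_eq]

theorem inl_mem_of_mulSingle_mem [Fintype α] {K : Subgroup (SignedPerm α)}
    (h : ∀ i, (inl (Pi.mulSingle i (-1)) : SignedPerm α) ∈ K) (a : α → ℤˣ) :
    (inl a : SignedPerm α) ∈ K := by
  rw [← Finset.univ_prod_mulSingle a]
  change _ ∈ K.comap inl
  refine Subgroup.prod_mem _ fun i _ => ?_
  rw [Subgroup.mem_comap]
  rcases Int.units_eq_one_or (a i) with e | e
  · rw [e, Pi.mulSingle_one, map_one]; exact one_mem _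
  · rw [e]; exact h i

/-- Conjugating one single sign change by permutations gives all of them. -/
theorem eq_top_of_inr_mem [Fintype α] {K : Subgroup (SignedPerm α)} (hK : ∀ g, inr g ∈ K) {i : α}
    (hi : inl (Pi.mulSingle i (-1)) ∈ K) : K = ⊤ := by
  refine eq_top_iff.2 fun x _ => ?_
  rw [← inl_left_mul_inr_right x]
  refine mul_mem (inl_mem_of_mulSingle_mem (fun j => ?_) _) (hK _)
  have := mul_mem (mul_mem (hK (swap i j)) hi) (inv_mem (hK (swap i j)))
  rwa [conj_inl_mulSingle, swap_apply_left] at this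

/-- The simple reflections of the group of signed permutations. -/
def simpleReflection (n : ℕ) (i : Fin n) : SignedPerm (Fin n) :=
  if h : (i : ℕ) + 1 < n then inr (swap i ⟨i + 1, h⟩) else inl (Pi.mulSingle i (-1))

theorem closure_range_simpleReflection (n : ℕ) [NeZero n] :
    Subgroup.closure (Set.range (simpleReflection n)) = ⊤ := by
  obtain ⟨m, rfl⟩ := Nat.exists_eq_succ_of_ne_zero (NeZero.ne n)
  have hmem : ∀ i, simpleReflection (m + 1) i ∈
      Subgroup.closure (Set.range (simpleReflection (m + 1))) :=
    fun i => Subgroup.subset_closure ⟨i, rfl⟩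
  refine eq_top_of_inr_mem (fun g => ?_) (i := Fin.last m) ?_
  · have hg : g ∈ Submonoid.closure (Set.range fun i : Fin m => swap i.castSucc i.succ) := by
      rw [Perm.mclosure_swap_castSucc_succ]; trivial
    induction hg using Submonoid.closure_induction with
    | mem x hx =>
      obtain ⟨i, rfl⟩ := hx
      have := hmem i.castSucc
      rwa [simpleReflection, dif_pos (by simp)] at this
    | one => rw [map_one]; exact one_mem _
    | mul x y _ _ hx hy => rw [map_mul]; exact mul_mem hx hy
  · have := hmem (Fin.last m)
    rwa [simpleReflection, dif_neg (by simp)] at this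

theorem simpleReflection_mul_self (n : ℕ) (i : Fin n) :
    simpleReflection n i * simpleReflection n i = 1 := by
  unfold simpleReflection
  split_ifs with h
  · rw [← map_mul, swap_mul_self, map_one]
  · rw [← map_mul, ← Pi.mulSingle_mul]
    simp

theorem simpleReflection_pow_of_lt (n : ℕ) {i j : Fin n} (hij : i < j) :
    (simpleReflection n i * simpleReflection n j) ^ (CoxeterMatrix.B n) i j = 1 := by
  have hi : (i : ℕ) + 1 < n := by have := j.2; have := Fin.lt_def.1 hij; omega
  have hlt := Fin.lt_def.1 hij
  have hjn := j.2
  have hM : (CoxeterMatrix.B n) i j = if (i : ℕ) + 1 = j then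
      (if (j : ℕ) + 1 = n then 4 else 3) else 2 := by
    change (if i = j then 1 else _) = _
    rw [if_neg hij.ne]
    split_ifs <;> omega
  rw [hM]
  split_ifs with h1 h2
  · have e : (⟨i + 1, hi⟩ : Fin n) = j := Fin.ext h1
    rw [simpleReflection, simpleReflection, dif_pos hi, dif_neg (by omega), e]
    -- The square is the sign change at both `i` and `j`, which is an involution; hence the exponent
    -- 4.
    have e2 : (inr (swap i j) * inl (Pi.mulSingle j (-1)) : SignedPerm (Fin n)) ^ 2 =
        inl (Pi.mulSingle i (-1) * Pi.mulSingle j (-1)) := by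
      have := conj_inl_mulSingle (swap i j) j (-1)
      rw [← map_inv, swap_inv, swap_apply_right] at this
      rw [pow_two, ← mul_assoc, this, map_mul]
    rw [show 4 = 2 * 2 from rfl, pow_mul, e2, pow_two, ← map_mul]
    simp [mul_mul_mul_comm, ← Pi.mulSingle_mul]
  · have e : (⟨i + 1, hi⟩ : Fin n) = j := Fin.ext h1
    have hj : (j : ℕ) + 1 < n := by omega
    rw [simpleReflection, simpleReflection, dif_pos hi, dif_pos hj, e, ← map_mul, ← map_pow,
      swap_comm i j]
    have := (Perm.isThreeCycle_swap_mul_swap_same (a := j) (b := i) (c := ⟨j + 1, hj⟩) hij.ne'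
      (by simp [Fin.ext_iff]) (by simp [Fin.ext_iff]; omega)).orderOf
    rw [← this, pow_orderOf_eq_one, map_one]
  · suffices h : Commute (simpleReflection n i) (simpleReflection n j) by
      rw [h.mul_pow, pow_two, pow_two, simpleReflection_mul_self, simpleReflection_mul_self,
        one_mul]
    rw [simpleReflection, dif_pos hi, simpleReflection]
    split_ifs with hj
    · refine Commute.map (Perm.Disjoint.commute fun k => ?_) inr
      by_cases hk : k = i ∨ (k : ℕ) = i + 1
      · right
        apply swap_apply_of_ne_of_ne
        · rintro rfl; rcases hk with rfl | hk <;> omega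
        · rintro rfl; rcases hk with hk | hk
          · simp [Fin.ext_iff] at hk; omega
          · simp at hk; omega
      · left
        rw [not_or] at hk
        exact swap_apply_of_ne_of_ne hk.1 fun e => hk.2 (by rw [e])
    · have := conj_inl_mulSingle (swap i ⟨i + 1, hi⟩) j (-1)
      rw [swap_apply_of_ne_of_ne hij.ne' (fun e => h1 (by rw [e]))] at this
      rw [mul_inv_eq_iff_eq_mul] at this
      exact this

theorem isLiftable_simpleReflection (n : ℕ) :
    (CoxeterMatrix.B n).IsLiftable (simpleReflection n) := by
  intro i j
  rcases lt_trichotomy i j with h | rfl | h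
  · exact simpleReflection_pow_of_lt n h
  · rw [simpleReflection_mul_self, one_pow]
  · have e : simpleReflection n i * simpleReflection n j =
        (simpleReflection n j * simpleReflection n i)⁻¹ := by
      rw [mul_inv_rev, inv_eq_of_mul_eq_one_left (simpleReflection_mul_self n i),
        inv_eq_of_mul_eq_one_left (simpleReflection_mul_self n j)]
    rw [e, inv_pow, CoxeterMatrix.symmetric, simpleReflection_pow_of_lt n h, inv_one]

end SignedPerm

/-! ### The Coxeter group of type B as signed permutations -/

section CoxeterB

open SemidirectProduct Equiv

theorem isTypeBFamily_simple (n : ℕ) :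
    IsTypeBFamily n fun i => if h : i < n then (CoxeterMatrix.B n).simple ⟨i, h⟩ else 1 := by
  have hM : ∀ i j (hi : i < n) (hj : j < n), i < j → (CoxeterMatrix.B n) ⟨i, hi⟩ ⟨j, hj⟩ =
      if i + 1 = j then (if j + 1 = n then 4 else 3) else 2 := by
    intro i j hi hj hij
    change (if (⟨i, hi⟩ : Fin n) = ⟨j, hj⟩ then 1 else _) = _
    rw [if_neg (by simp; omega)]
    simp only
    split_ifs <;> omega
  have sq := fun i => (CoxeterMatrix.B n).toCoxeterSystem.simple_mul_simple_self i
  have rel := fun i j => (CoxeterMatrix.B n).toCoxeterSystem.simple_mul_simple_pow i j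
  simp only [CoxeterMatrix.toCoxeterSystem_simple] at sq rel
  have inv := fun i => inv_eq_of_mul_eq_one_left (sq i)
  refine ⟨fun i hi => ?_, fun i j hij hj => ?_, fun i hi => ?_, fun i hi => ?_⟩
  · simp only [dif_pos hi]; exact sq _
  · have hi : i < n := by omega
    have := rel ⟨i, hi⟩ ⟨j, hj⟩
    rw [hM _ _ _ _ (by omega), if_neg (by omega), pow_two] at this
    simp only [dif_pos hi, dif_pos hj]
    rw [eq_inv_of_mul_eq_one_left this, mul_inv_rev, inv, inv]
  · have h1 : i < n := by omega
    have h2 : i + 1 < n := by omega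
    have := rel ⟨i, h1⟩ ⟨i + 1, h2⟩
    rw [hM _ _ _ _ (by omega), if_pos rfl, if_neg (by omega)] at this
    simp only [dif_pos h1, dif_pos h2]
    rw [← mul_inv_eq_one, ← this]
    simp only [mul_inv_rev, inv, pow_succ, pow_zero, one_mul, mul_assoc]
  · have h1 : i < n := by omega
    have h2 : i + 1 < n := by omega
    have := rel ⟨i, h1⟩ ⟨i + 1, h2⟩
    rw [hM _ _ _ _ (by omega), if_pos rfl, if_pos (by omega)] at this
    simp only [dif_pos h1, dif_pos h2]
    rw [← mul_inv_eq_one, ← this]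
    simp only [mul_inv_rev, inv, pow_succ, pow_zero, one_mul, mul_assoc]

/-- The homomorphism from the Coxeter group of type `B n` to the signed permutations. -/
def coxeterToSignedPerm (n : ℕ) : (CoxeterMatrix.B n).Group →* SignedPerm (Fin n) :=
  (CoxeterMatrix.B n).toCoxeterSystem.lift ⟨_, SignedPerm.isLiftable_simpleReflection n⟩

theorem coxeterToSignedPerm_simple (n : ℕ) (i : Fin n) :
    coxeterToSignedPerm n ((CoxeterMatrix.B n).simple i) = SignedPerm.simpleReflection n i :=
  (CoxeterMatrix.B n).toCoxeterSystem.lift_apply_simple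
    (SignedPerm.isLiftable_simpleReflection n) i

theorem coxeterToSignedPerm_surjective (n : ℕ) [NeZero n] :
    Function.Surjective (coxeterToSignedPerm n) := by
  rw [← MonoidHom.range_eq_top, eq_top_iff, ← SignedPerm.closure_range_simpleReflection,
    Subgroup.closure_le]
  rintro _ ⟨i, rfl⟩
  exact ⟨_, coxeterToSignedPerm_simple n i⟩

theorem coxeterToSignedPerm_injective (n : ℕ) [NeZero n] :
    Function.Injective (coxeterToSignedPerm n) := by
  refine (injective_iff_map_eq_one _).2 fun w hw => ?_
  have hval : ∀ i < n, ((Fin.ofNat n i : Fin n) : ℕ) = i := fun i hi => Nat.mod_eq_of_lt hi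
  have hs : ∀ i (hi : i + 1 < n), coxeterToSignedPerm n
      (if h : i < n then (CoxeterMatrix.B n).simple ⟨i, h⟩ else 1) =
        inr (swap (Fin.ofNat n i) (Fin.ofNat n (i + 1))) := by
    intro i hi
    rw [dif_pos (by omega), coxeterToSignedPerm_simple, SignedPerm.simpleReflection, dif_pos hi]
    congr 2 <;> exact Fin.ext (hval _ (by omega)).symm
  have hl : ∀ i (hi : i + 1 = n), coxeterToSignedPerm n
      (if h : i < n then (CoxeterMatrix.B n).simple ⟨i, h⟩ else 1) =
        inl (Pi.mulSingle (Fin.ofNat n i) (-1)) := by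
    intro i hi
    rw [dif_pos (by omega), coxeterToSignedPerm_simple, SignedPerm.simpleReflection,
      dif_neg (by simp [hi])]
    congr 2
    exact Fin.ext (hval _ (by omega)).symm
  have hne : ∀ i j, i < n → j < n → i ≠ j → Fin.ofNat n i ≠ Fin.ofNat n j := by
    intro i j hi hj hij e
    exact hij (by rw [← hval i hi, ← hval j hj, e])
  -- The vectors ±e i are the signed points `(i, 1)` and `(i, -1)`. Only `i < n` matters, so the
  -- reduction modulo `n` in `Fin.ofNat` has no effect.
  refine (isTypeBFamily_simple n).eq_one_of_map_eq_one
    (SignedPerm.toPerm.comp (coxeterToSignedPerm n)) (fun i => (Fin.ofNat n i, 1))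
    (fun i => (Fin.ofNat n i, -1)) ?_ ?_ ?_ ?_ ?_ ?_ ?_ ?_
  · intro i hi
    rw [MonoidHom.comp_apply, hs i hi, SignedPerm.toPerm_apply]
    simp
  · intro k i hki hi
    rcases Nat.lt_or_ge (i + 1) n with h1 | h1
    · rw [MonoidHom.comp_apply, hs i h1, SignedPerm.toPerm_apply, right_inr, left_inr,
        swap_apply_of_ne_of_ne (hne _ _ (by omega) hi (by omega))
          (hne _ _ (by omega) h1 (by omega))]
      simp
    · rw [MonoidHom.comp_apply, hl i (by omega), SignedPerm.toPerm_apply, right_inl, left_inl,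
        Perm.one_apply, Pi.mulSingle_eq_of_ne (hne _ _ (by omega) hi (by omega))]
      simp
  · intro i hi
    rw [MonoidHom.comp_apply, hl i hi, SignedPerm.toPerm_apply]
    simp
  · intro i hi
    rw [MonoidHom.comp_apply, hs i hi, SignedPerm.toPerm_apply]
    simp
  · intro i j hij hj e
    exact hne i j (by omega) hj hij.ne (congrArg Prod.fst e)
  · intro i j _ _ e
    exact (show (1 : ℤˣ) ≠ -1 by decide) (congrArg Prod.snd e)
  · have := (CoxeterMatrix.B n).toCoxeterSystem.subgroup_closure_range_simple
    have hmem : w ∈ Subgroup.closure (Set.range (CoxeterMatrix.B n).toCoxeterSystem.simple) := by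
      rw [this]; trivial
    refine Subgroup.closure_mono ?_ hmem
    rintro _ ⟨i, rfl⟩
    refine ⟨i, ⟨Nat.zero_le _, i.2⟩, ?_⟩
    simp
  · rw [MonoidHom.comp_apply, hw, map_one]

/-- The Coxeter group of type `B n` is the group of signed permutations of `Fin n`. -/
noncomputable def coxeterEquivSignedPerm (n : ℕ) [NeZero n] :
    (CoxeterMatrix.B n).Group ≃* SignedPerm (Fin n) :=
  MulEquiv.ofBijective (coxeterToSignedPerm n)
    ⟨coxeterToSignedPerm_injective n, coxeterToSignedPerm_surjective n⟩

end CoxeterB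

/-! ### The first three permutations generate the symmetric group -/

section BasePerms

open Equiv

theorem swap_mem_of_conj {α : Type*} [DecidableEq α] {K : Subgroup (Perm α)} {g : Perm α}
    (hg : g ∈ K) {a b a' b' : α} (h : swap a b ∈ K) (ha : g a = a') (hb : g b = b') :
    swap a' b' ∈ K := by
  rw [← ha, ← hb, swap_apply_apply]
  exact mul_mem (mul_mem hg h) (inv_mem hg)

theorem eq_top_of_forall_swap_mem {α : Type*} [DecidableEq α] [Finite α] {K : Subgroup (Perm α)}
    (c : α) (h : ∀ a, swap a c ∈ K) : K = ⊤ := by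
  rw [eq_top_iff, ← Perm.closure_isSwap, Subgroup.closure_le]
  rintro _ ⟨a, b, -, rfl⟩
  exact SubmonoidClass.swap_mem_trans _ (h a) (swap_comm c b ▸ h b)

/-- The involution of `Fin n` given by an involutive function on `{0, …, n - 1}`. -/
def involutivePerm (n : ℕ) (f : ℕ → ℕ) (hf : ∀ i < n, f i < n ∧ f (f i) = i) : Perm (Fin n) where
  toFun i := ⟨f i, (hf i i.2).1⟩
  invFun i := ⟨f i, (hf i i.2).1⟩
  left_inv i := Fin.ext (hf i i.2).2
  right_inv i := Fin.ext (hf i i.2).2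

theorem involutivePerm_mul_self {n : ℕ} {f : ℕ → ℕ} (hf : ∀ i < n, f i < n ∧ f (f i) = i) :
    involutivePerm n f hf * involutivePerm n f hf = 1 :=
  Perm.ext fun i => Fin.ext (hf i i.2).2

/-- The permutation `(0 1)(2 3)⋯`. -/
def base1 (n : ℕ) : Perm (Fin n) :=
  involutivePerm n (fun i => if i % 2 = 1 then i - 1 else if i + 1 < n then i + 1 else i) <| by
    intro i hi
    split_ifs <;> omega

/-- The permutation `(3 4)(5 6)⋯`. -/
def base2 (n : ℕ) : Perm (Fin n) :=
  involutivePerm n (fun i => if i < 3 then i else if i % 2 = 0 then i - 1 else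
    if i + 1 < n then i + 1 else i) <| by
    intro i hi
    split_ifs <;> omega

/-- The permutation `(0 2)(1 3)`. -/
def base3 (n : ℕ) : Perm (Fin n) :=
  involutivePerm n (fun i => if i < 2 then (if i + 2 < n then i + 2 else i) else
    if i < 4 then i - 2 else i) <| by
    intro i hi
    split_ifs <;> omega

/-- The permutation `(0 1)`. -/
def base4 (n : ℕ) : Perm (Fin n) :=
  involutivePerm n (fun i => if i < 2 then (if 1 < n then 1 - i else i) else i) <| by
    intro i hi
    split_ifs <;> omega

section Base

variable {n : ℕ}

theorem base1_apply (i : Fin n) : (base1 n i : ℕ) =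
    if (i : ℕ) % 2 = 1 then (i : ℕ) - 1 else if (i : ℕ) + 1 < n then (i : ℕ) + 1 else i := rfl

theorem base2_apply (i : Fin n) : (base2 n i : ℕ) =
    if (i : ℕ) < 3 then (i : ℕ) else if (i : ℕ) % 2 = 0 then (i : ℕ) - 1 else
      if (i : ℕ) + 1 < n then (i : ℕ) + 1 else i := rfl

theorem base3_apply (i : Fin n) : (base3 n i : ℕ) =
    if (i : ℕ) < 2 then (if (i : ℕ) + 2 < n then (i : ℕ) + 2 else i) else
      if (i : ℕ) < 4 then (i : ℕ) - 2 else i := rfl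

theorem base4_apply (i : Fin n) : (base4 n i : ℕ) =
    if (i : ℕ) < 2 then (if 1 < n then 1 - (i : ℕ) else i) else i := rfl

theorem base1_comm_base3 (hn : 4 ≤ n) : Commute (base1 n) (base3 n) := by
  refine Perm.ext fun i => Fin.ext ?_
  have := i.2
  simp only [Perm.mul_apply, base1_apply, base3_apply]
  split_ifs <;> omega

theorem base1_comm_base4 (n : ℕ) : Commute (base1 n) (base4 n) := by
  refine Perm.ext fun i => Fin.ext ?_
  have := i.2
  simp only [Perm.mul_apply, base1_apply, base4_apply]
  split_ifs <;> omega

theorem base2_comm_base4 (n : ℕ) : Commute (base2 n) (base4 n) := by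
  refine Perm.ext fun i => Fin.ext ?_
  have := i.2
  simp only [Perm.mul_apply, base2_apply, base4_apply]
  split_ifs <;> omega

/-- The position of a point in the cycle `(2 3 5 ⋯ n-2 n-1 n-3 ⋯ 4)` of `base1 n * base2 n`. -/
def cyclePos (n i : ℕ) : ℕ :=
  if i % 2 = 1 then (i - 1) / 2 else if i = 2 then 0 else n - 2 - (i - 2) / 2

variable (hodd : Odd n) (hn : 5 ≤ n)

include hodd hn

/-- On these points the product goes up by 2 through the odd numbers to `n - 2`, crosses to `n - 1`,
goes down by 2 through the even numbers to 2, and returns to 3. Only the step from 4 to 2 wraps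
around in `cyclePos`. -/
theorem base_mul_apply_of_le {i : Fin n} (hi : 2 ≤ (i : ℕ)) :
    2 ≤ ((base1 n * base2 n) i : ℕ) ∧
    (cyclePos n ((base1 n * base2 n) i) : ZMod (n - 2)) = (cyclePos n i : ZMod (n - 2)) + 1 := by
  obtain ⟨m, rfl⟩ := hodd
  have := i.2
  have key : ((base1 (2 * m + 1) * base2 (2 * m + 1)) i : ℕ) = if (i : ℕ) = 2 then 3 else
      if (i : ℕ) % 2 = 0 then (i : ℕ) - 2 else
      if (i : ℕ) + 2 < 2 * m + 1 then (i : ℕ) + 2 else (i : ℕ) + 1 := by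
    simp only [Perm.mul_apply, base1_apply, base2_apply]
    split_ifs <;> omega
  refine ⟨by rw [key]; split_ifs <;> omega, ?_⟩
  have h : cyclePos (2 * m + 1) ((base1 (2 * m + 1) * base2 (2 * m + 1)) i) =
        cyclePos (2 * m + 1) i + 1 ∨
      cyclePos (2 * m + 1) ((base1 (2 * m + 1) * base2 (2 * m + 1)) i) + (2 * m + 1 - 2) =
        cyclePos (2 * m + 1) i + 1 := by
    rw [key]
    simp only [cyclePos]
    split_ifs <;> omega
  rcases h with h | h
  · rw [h, Nat.cast_add, Nat.cast_one]
  · have := congrArg (Nat.cast : ℕ → ZMod (2 * m + 1 - 2)) h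
    rwa [Nat.cast_add, ZMod.natCast_self, add_zero, Nat.cast_add, Nat.cast_one] at this

theorem base_mul_pow_apply_of_le {i : Fin n} (hi : 2 ≤ (i : ℕ)) (k : ℕ) :
    2 ≤ (((base1 n * base2 n) ^ k) i : ℕ) ∧
    (cyclePos n (((base1 n * base2 n) ^ k) i) : ZMod (n - 2)) =
      (cyclePos n i : ZMod (n - 2)) + k := by
  induction k with
  | zero => simpa using hi
  | succ k ih =>
    have := base_mul_apply_of_le hodd hn ih.1
    rw [pow_succ', Perm.mul_apply]
    refine ⟨this.1, ?_⟩
    rw [this.2, ih.2]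
    push_cast
    ring

theorem base_mul_pow_apply_eq_iff {i : Fin n} (hi : 2 ≤ (i : ℕ)) (k : ℕ) :
    ((base1 n * base2 n) ^ k) i = i ↔ n - 2 ∣ k := by
  obtain ⟨h1, h2⟩ := base_mul_pow_apply_of_le hodd hn hi k
  rw [← CharP.cast_eq_zero_iff (ZMod (n - 2)) (n - 2) k]
  constructor
  · intro h
    rw [h] at h2
    simpa using h2.symm
  · intro h
    rw [h, add_zero, ZMod.natCast_eq_natCast_iff'] at h2
    set j := ((base1 n * base2 n) ^ k) i
    have hj := j.2
    have hi' := i.2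
    obtain ⟨m, rfl⟩ := hodd
    rw [Nat.mod_eq_of_lt (by simp only [cyclePos]; split_ifs <;> omega),
      Nat.mod_eq_of_lt (by simp only [cyclePos]; split_ifs <;> omega)] at h2
    refine Fin.ext ?_
    simp only [cyclePos] at h2
    split_ifs at h2 <;> omega

omit hodd in
theorem base_mul_pow_apply_of_lt {i : Fin n} (hi : (i : ℕ) < 2) (k : ℕ) :
    (((base1 n * base2 n) ^ k) i : ℕ) = (i + k) % 2 := by
  induction k with
  | zero => simp; omega
  | succ k ih =>
    rw [pow_succ', Perm.mul_apply, Perm.mul_apply, base1_apply, base2_apply, ih]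
    split_ifs <;> omega

/-- The product is (0 1) times an (n - 2)-cycle on the other points. As `n` is odd, the two lengths
are coprime. -/
theorem orderOf_base_mul : orderOf (base1 n * base2 n) = 2 * n - 4 := by
  have hcop : Nat.Coprime 2 (n - 2) := by
    rw [Nat.coprime_two_left]
    obtain ⟨m, rfl⟩ := hodd
    exact ⟨m - 1, by omega⟩
  have key : ∀ k, (base1 n * base2 n) ^ k = 1 ↔ 2 * n - 4 ∣ k := by
    intro k
    rw [show 2 * n - 4 = 2 * (n - 2) by omega]
    constructor
    · intro h
      refine hcop.mul_dvd_of_dvd_of_dvd ?_ ?_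
      · have := base_mul_pow_apply_of_lt hn (i := ⟨0, by omega⟩) (by simp) k
        rw [h] at this
        simp at this
        omega
      · rw [← base_mul_pow_apply_eq_iff hodd hn (i := ⟨2, by omega⟩) (by simp), h]
        rfl
    · intro h
      refine Perm.ext fun i => ?_
      rcases Nat.lt_or_ge (i : ℕ) 2 with hi | hi
      · refine Fin.ext ?_
        rw [base_mul_pow_apply_of_lt hn hi]
        obtain ⟨c, rfl⟩ := (Dvd.intro _ rfl).trans h
        simp
        omega
      · exact (base_mul_pow_apply_eq_iff hodd hn hi k).2 ((Dvd.intro_left _ rfl).trans h)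
  exact Nat.dvd_antisymm (orderOf_dvd_of_pow_eq_one ((key _).2 dvd_rfl))
    ((key _).1 (pow_orderOf_eq_one _))

theorem base_mul_pow_eq_swap :
    (base1 n * base2 n) ^ (n - 2) = swap ⟨0, by omega⟩ ⟨1, by omega⟩ := by
  refine Perm.ext fun i => ?_
  rcases Nat.lt_or_ge (i : ℕ) 2 with hi | hi
  · refine Fin.ext ?_
    rw [base_mul_pow_apply_of_lt hn hi]
    obtain ⟨m, hm⟩ := hodd
    rcases (by omega : (i : ℕ) = 0 ∨ (i : ℕ) = 1) with h | h
    · rw [h, (Fin.ext h : i = ⟨0, by omega⟩), swap_apply_left]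
      simp only
      omega
    · rw [h, (Fin.ext h : i = ⟨1, by omega⟩), swap_apply_right]
      simp only
      omega
  · rw [(base_mul_pow_apply_eq_iff hodd hn hi _).2 dvd_rfl, swap_apply_of_ne_of_ne] <;>
    · rintro rfl
      simp at hi

/-- From (0 1), a power of `base1 n * base2 n`, conjugation gives (2 3), (2 4) and (0 4).
Conjugating by `base1 n` and `base2 n` in turn shifts (2 4) to (3 5), (4 6), and so on. These
transpositions connect all points. -/
theorem eq_top_of_base_mem {K : Subgroup (Perm (Fin n))} (h1 : base1 n ∈ K) (h2 : base2 n ∈ K)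
    (h3 : base3 n ∈ K) : K = ⊤ := by
  obtain ⟨m, hm⟩ := hodd
  have s01 : swap (⟨0, by omega⟩ : Fin n) ⟨1, by omega⟩ ∈ K := by
    rw [← base_mul_pow_eq_swap ⟨m, hm⟩ hn]
    exact pow_mem (mul_mem h1 h2) _
  have s23 : swap (⟨2, by omega⟩ : Fin n) ⟨3, by omega⟩ ∈ K := by
    refine swap_mem_of_conj h3 s01 (Fin.ext ?_) (Fin.ext ?_) <;> rw [base3_apply] <;> simp <;> omega
  have s24 : swap (⟨2, by omega⟩ : Fin n) ⟨4, by omega⟩ ∈ K := by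
    refine swap_mem_of_conj h2 s23 (Fin.ext ?_) (Fin.ext ?_) <;> rw [base2_apply] <;> simp <;> omega
  have s04 : swap (⟨0, by omega⟩ : Fin n) ⟨4, by omega⟩ ∈ K := by
    refine swap_mem_of_conj h3 s24 (Fin.ext ?_) (Fin.ext ?_) <;> rw [base3_apply] <;> simp
  have step : ∀ i (hi : i + 4 < n), swap (⟨i + 2, by omega⟩ : Fin n) ⟨i + 4, hi⟩ ∈ K := by
    intro i
    induction i with
    | zero => exact fun _ => s24
    | succ i ih =>
      intro hi
      rcases Nat.mod_two_eq_zero_or_one i with h | h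
      · refine swap_mem_of_conj h1 (ih (by omega)) (Fin.ext ?_) (Fin.ext ?_) <;>
          rw [base1_apply] <;> simp only <;> split_ifs <;> omega
      · refine swap_mem_of_conj h2 (ih (by omega)) (Fin.ext ?_) (Fin.ext ?_) <;>
          rw [base2_apply] <;> simp only <;> split_ifs <;> omega
  have all : ∀ i (hi : i < n), swap (⟨i, hi⟩ : Fin n) ⟨2, by omega⟩ ∈ K := by
    intro i
    induction i using Nat.strong_induction_on with
    | _ i ih =>
      intro hi
      have h0 : swap (⟨0, by omega⟩ : Fin n) ⟨2, by omega⟩ ∈ K :=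
        SubmonoidClass.swap_mem_trans _ s04 (swap_comm (⟨2, _⟩ : Fin n) _ ▸ s24)
      rcases (by omega : i = 0 ∨ i = 1 ∨ i = 2 ∨ i = 3 ∨ 4 ≤ i) with rfl | rfl | rfl | rfl | h4
      · exact h0
      · exact SubmonoidClass.swap_mem_trans _ (swap_comm (⟨0, _⟩ : Fin n) _ ▸ s01) h0
      · rw [swap_self]; exact one_mem _
      · exact swap_comm (⟨2, _⟩ : Fin n) _ ▸ s23
      · obtain ⟨j, rfl⟩ : ∃ j, i = j + 4 := ⟨i - 4, by omega⟩
        exact SubmonoidClass.swap_mem_trans _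
          (swap_comm (⟨j + 2, _⟩ : Fin n) _ ▸ step j hi) (ih (j + 2) (by omega) (by omega))
  exact eq_top_of_forall_swap_mem ⟨2, by omega⟩ fun a => all a a.2

end Base

end BasePerms

/-! ### The facet generated by the last three elements -/

section FacetHom

open Equiv SemidirectProduct

section Facet

variable {n : ℕ}

/-- The permutation `(5 6)(7 8)⋯`. -/
def tail (n : ℕ) : Perm (Fin n) :=
  involutivePerm n (fun i => if i < 5 then i else if i % 2 = 0 then i - 1 else
    if i + 1 < n then i + 1 else i) <| by
    intro i hi
    split_ifs <;> omega

theorem tail_apply (i : Fin n) : (tail n i : ℕ) =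
    if (i : ℕ) < 5 then (i : ℕ) else if (i : ℕ) % 2 = 0 then (i : ℕ) - 1 else
      if (i : ℕ) + 1 < n then (i : ℕ) + 1 else i := rfl

theorem five_le_tail {i : Fin n} (hi : 5 ≤ (i : ℕ)) : 5 ≤ (tail n i : ℕ) := by
  rw [tail_apply]; split_ifs <;> omega

/-- The homomorphism from the sign group sending `-1` to `tail n`. -/
def tailHom (n : ℕ) : ℤˣ →* Perm (Fin n) where
  toFun e := if e = 1 then 1 else tail n
  map_one' := if_pos rfl
  map_mul' a b := by
    rcases Int.units_eq_one_or a with rfl | rfl <;> rcases Int.units_eq_one_or b with rfl | rfl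
    · simp
    · simp
    · simp
    · simp [tail, involutivePerm_mul_self]

theorem tailHom_neg_one (n : ℕ) : tailHom n (-1) = tail n := by
  change (if (-1 : ℤˣ) = 1 then 1 else tail n) = tail n
  exact if_neg (by decide)

theorem five_le_tailHom (e : ℤˣ) {i : Fin n} (hi : 5 ≤ (i : ℕ)) : 5 ≤ (tailHom n e i : ℕ) := by
  rcases Int.units_eq_one_or e with rfl | rfl
  · rwa [map_one, Perm.one_apply]
  · rw [tailHom_neg_one]; exact five_le_tail hi

variable (hn : 5 ≤ n)

theorem tailHom_castLE (e : ℤˣ) (i : Fin 5) : tailHom n e (Fin.castLE hn i) = Fin.castLE hn i := by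
  rcases Int.units_eq_one_or e with rfl | rfl
  · rw [map_one, Perm.one_apply]
  · rw [tailHom_neg_one]
    refine Fin.ext ?_
    rw [tail_apply, if_pos (by simp)]

/-- The permutations of the first five points of `Fin n`. -/
noncomputable def smallEmbed : Perm (Fin 5) →* Perm (Fin n) :=
  Perm.viaEmbeddingHom (Fin.castLEEmb hn)

theorem smallEmbed_castLE (g : Perm (Fin 5)) (i : Fin 5) :
    smallEmbed hn g (Fin.castLE hn i) = Fin.castLE hn (g i) :=
  Perm.viaEmbedding_apply g (Fin.castLEEmb hn) i

theorem smallEmbed_of_le (g : Perm (Fin 5)) {i : Fin n} (hi : 5 ≤ (i : ℕ)) :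
    smallEmbed hn g i = i := by
  refine Perm.viaEmbedding_apply_of_notMem g (Fin.castLEEmb hn) i ?_
  rintro ⟨j, rfl⟩
  have := j.2
  simp at hi
  omega

theorem eq_castLE_or_five_le (i : Fin n) : (∃ j, i = Fin.castLE hn j) ∨ 5 ≤ (i : ℕ) := by
  rcases Nat.lt_or_ge (i : ℕ) 5 with h | h
  · exact Or.inl ⟨⟨i, h⟩, rfl⟩
  · exact Or.inr h

theorem smallEmbed_commute_tailHom (g : Perm (Fin 5)) (e : ℤˣ) :
    Commute (smallEmbed hn g) (tailHom n e) := by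
  refine Perm.ext fun i => ?_
  rw [Perm.mul_apply, Perm.mul_apply]
  rcases eq_castLE_or_five_le hn i with ⟨j, rfl⟩ | h
  · rw [tailHom_castLE, smallEmbed_castLE, tailHom_castLE]
  · rw [smallEmbed_of_le hn g h, smallEmbed_of_le hn g (five_le_tailHom e h)]

/-- The permutation part of `facetHom`. -/
noncomputable def facetPerm : ℤˣ × Perm (Fin 5) →* Perm (Fin n) where
  toFun x := smallEmbed hn x.2 * tailHom n (x.1 * Perm.sign x.2)
  map_one' := by simp
  map_mul' x y := by
    simp only [Prod.fst_mul, Prod.snd_mul, map_mul]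
    have h := fun e => (smallEmbed_commute_tailHom hn y.2 e).eq
    have h2 : ∀ a b, tailHom n a * tailHom n b = tailHom n b * tailHom n a := fun a b => by
      rw [← map_mul, mul_comm, map_mul]
    calc _ = smallEmbed hn x.2 * (smallEmbed hn y.2 * tailHom n x.1) * tailHom n y.1 *
          tailHom n (Perm.sign x.2) * tailHom n (Perm.sign y.2) := by simp only [mul_assoc]
      _ = smallEmbed hn x.2 * tailHom n x.1 * smallEmbed hn y.2 *
          (tailHom n y.1 * tailHom n (Perm.sign x.2)) * tailHom n (Perm.sign y.2) := by
        rw [h]; simp only [mul_assoc]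
      _ = smallEmbed hn x.2 * tailHom n x.1 * (smallEmbed hn y.2 *
          tailHom n (Perm.sign x.2)) * tailHom n y.1 * tailHom n (Perm.sign y.2) := by
        rw [h2]; simp only [mul_assoc]
      _ = _ := by rw [h]; simp only [mul_assoc]

theorem facetPerm_apply (x : ℤˣ × Perm (Fin 5)) :
    facetPerm hn x = smallEmbed hn x.2 * tailHom n (x.1 * Perm.sign x.2) := rfl

theorem facetPerm_castLE (x : ℤˣ × Perm (Fin 5)) (i : Fin 5) :
    facetPerm hn x (Fin.castLE hn i) = Fin.castLE hn (x.2 i) := by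
  rw [facetPerm_apply, Perm.mul_apply, tailHom_castLE, smallEmbed_castLE]

theorem facetPerm_of_le (x : ℤˣ × Perm (Fin 5)) {i : Fin n} (hi : 5 ≤ (i : ℕ)) :
    facetPerm hn x i = tailHom n (x.1 * Perm.sign x.2) i := by
  rw [facetPerm_apply, Perm.mul_apply, smallEmbed_of_le hn _ (five_le_tailHom _ hi)]

theorem snd_eq_of_facetPerm_eq {x y : ℤˣ × Perm (Fin 5)} (h : facetPerm hn x = facetPerm hn y) :
    x.2 = y.2 := by
  refine Perm.ext fun i => Fin.castLE_injective hn ?_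
  rw [← facetPerm_castLE, ← facetPerm_castLE, h]

/-- The sign vector conjugating the facet to standard form. -/
def twist (i : ℕ) : ℤˣ := if i = 1 ∨ i = 3 ∨ i = 4 then -1 else 1

theorem twist_of_le {i : ℕ} (hi : 5 ≤ i) : twist i = 1 := if_neg (by omega)

/-- The embedding of `ℤˣ × Perm (Fin 5)` with image the subgroup generated by the last three
elements of the string. -/
noncomputable def facetHom : ℤˣ × Perm (Fin 5) →* SignedPerm (Fin n) where
  toFun x := ⟨fun i => twist i * twist ((facetPerm hn x)⁻¹ i : Fin n) * x.1, facetPerm hn x⟩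
  map_one' := by
    refine SemidirectProduct.ext (funext fun i => ?_) (map_one _)
    rw [map_one, inv_one]
    exact (mul_one _).trans (Int.units_mul_self _)
  map_mul' x y := by
    refine SemidirectProduct.ext (funext fun i => ?_) (map_mul _ _ _)
    rw [SignedPerm.mul_left_apply]
    simp only [map_mul, mul_inv_rev, Perm.mul_apply, Prod.fst_mul]
    -- Here `b` is the twist at the intermediate point; it occurs twice and cancels.
    exact (by decide : ∀ a b c e f : ℤˣ, a * c * (e * f) = a * b * e * (b * c * f)) _ _ _ _ _

theorem facetHom_right (x : ℤˣ × Perm (Fin 5)) : (facetHom hn x).right = facetPerm hn x := rfl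

theorem facetHom_left (x : ℤˣ × Perm (Fin 5)) (i : Fin n) :
    (facetHom hn x).left i = twist i * twist ((facetPerm hn x)⁻¹ i : Fin n) * x.1 := rfl

theorem facetHom_left_castLE (x : ℤˣ × Perm (Fin 5)) (i : Fin 5) :
    (facetHom hn x).left (Fin.castLE hn i) = twist i * twist (x.2⁻¹ i : Fin 5) * x.1 := by
  rw [facetHom_left, ← map_inv, facetPerm_castLE]
  rfl

theorem facetHom_left_of_le (x : ℤˣ × Perm (Fin 5)) {i : Fin n} (hi : 5 ≤ (i : ℕ)) :
    (facetHom hn x).left i = x.1 := by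
  rw [facetHom_left, ← map_inv, facetPerm_of_le hn _ hi, twist_of_le hi,
    twist_of_le (five_le_tailHom _ hi), one_mul, one_mul]

theorem facetHom_injective : Function.Injective (facetHom hn) := by
  refine (injective_iff_map_eq_one _).2 fun x hx => ?_
  have h2 : x.2 = 1 := by
    refine snd_eq_of_facetPerm_eq hn (y := 1) ?_
    rw [← facetHom_right, hx, map_one]
    rfl
  refine Prod.ext ?_ h2
  have := facetHom_left_castLE hn x 0
  rw [hx, h2] at this
  simpa [twist] using this.symm

end Facet

/-- The string of generators of the group of signed permutations. -/
def signedString (n : ℕ) : Fin 4 → SignedPerm (Fin n) :=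
  ![inr (base1 n), inr (base2 n), inr (base3 n),
    inl (fun i : Fin n => if (i : ℕ) < 2 then (1 : ℤˣ) else -1) * inr (base4 n)]

/-- The elements of `ℤˣ × Perm (Fin 5)` corresponding to the last three generators. -/
def facetString : Fin 3 → ℤˣ × Perm (Fin 5) :=
  ![(1, swap 3 4), (1, swap 0 2 * swap 1 3), (-1, swap 0 1)]

section String

variable {n : ℕ} (hn : 5 ≤ n)

theorem perm_ext_castLE {g h : Perm (Fin n)}
    (h1 : ∀ j, g (Fin.castLE hn j) = h (Fin.castLE hn j)) (h2 : ∀ i : Fin n, 5 ≤ (i : ℕ) → g i = h i) :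
    g = h := by
  refine Perm.ext fun i => ?_
  rcases eq_castLE_or_five_le hn i with ⟨j, rfl⟩ | hi
  · exact h1 j
  · exact h2 i hi

theorem facetPerm_facetString_zero (hodd : Odd n) : facetPerm hn (facetString 0) = base2 n := by
  refine perm_ext_castLE hn (fun j => ?_) fun i hi => ?_
  · obtain ⟨m, hm⟩ := hodd
    rw [facetPerm_castLE]
    refine Fin.ext ?_
    rw [base2_apply]
    fin_cases j <;> simp [facetString, swap_apply_def] <;> omega
  · have e : (facetString 0).1 * Perm.sign (facetString 0).2 = -1 := by decide
    rw [facetPerm_of_le hn _ hi, e, tailHom_neg_one]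
    refine Fin.ext ?_
    rw [tail_apply, base2_apply]
    split_ifs <;> omega

theorem facetPerm_facetString_one : facetPerm hn (facetString 1) = base3 n := by
  refine perm_ext_castLE hn (fun j => ?_) fun i hi => ?_
  · rw [facetPerm_castLE]
    refine Fin.ext ?_
    rw [base3_apply]
    fin_cases j <;> simp [facetString, swap_apply_def] <;> omega
  · have e : (facetString 1).1 * Perm.sign (facetString 1).2 = 1 := by decide
    rw [facetPerm_of_le hn _ hi, e, map_one]
    refine Fin.ext ?_
    rw [base3_apply, if_neg (by omega), if_neg (by omega)]
    rfl

theorem facetPerm_facetString_two : facetPerm hn (facetString 2) = base4 n := by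
  refine perm_ext_castLE hn (fun j => ?_) fun i hi => ?_
  · rw [facetPerm_castLE]
    refine Fin.ext ?_
    rw [base4_apply]
    fin_cases j <;> simp [facetString, swap_apply_def] <;> omega
  · have e : (facetString 2).1 * Perm.sign (facetString 2).2 = 1 := by decide
    rw [facetPerm_of_le hn _ hi, e, map_one]
    refine Fin.ext ?_
    rw [base4_apply, if_neg (by omega)]
    rfl

/-- The twist is constant on the orbits of the first two permutations, so these acquire no signs. It
differs at 0 and 1, so for (0 1) the scalar -1 is cancelled at exactly these two indices. -/
theorem facetHom_facetString (hodd : Odd n) (i : Fin 3) :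
    facetHom hn (facetString i) = signedString n i.succ := by
  have hleft : ∀ i j, (facetHom hn (facetString i)).left j = (signedString n i.succ).left j := by
    intro i j
    rcases eq_castLE_or_five_le hn j with ⟨j, rfl⟩ | hj
    · rw [facetHom_left_castLE]
      have e : (signedString n i.succ).left (Fin.castLE hn j) =
          if i = 2 then (if (j : ℕ) < 2 then 1 else -1) else 1 := by
        fin_cases i <;> simp [signedString]
      rw [e]
      clear e
      revert i j
      decide
    · rw [facetHom_left_of_le hn _ hj]
      fin_cases i
      · rfl
      · rfl
      · simp [signedString, facetString]
        omega
  refine SemidirectProduct.ext (funext (hleft i)) ?_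
  rw [facetHom_right]
  fin_cases i
  · exact facetPerm_facetString_zero hn hodd
  · exact facetPerm_facetString_one hn
  · refine (facetPerm_facetString_two hn).trans ?_
    simp [signedString]

end String

/-- Conjugating (3 4) by the generators gives every (a 4) with trivial sign, hence Sym(5). The third
generator then supplies -1. -/
theorem closure_range_facetString : Subgroup.closure (Set.range facetString) = ⊤ := by
  set L := Subgroup.closure (Set.range facetString)
  have hL : ∀ i, facetString i ∈ L := fun i => Subgroup.subset_closure ⟨i, rfl⟩
  have conj : ∀ x ∈ L, ∀ a b, ((1, swap a b) : ℤˣ × Perm (Fin 5)) ∈ L →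
      ((1, swap (x.2 a) (x.2 b)) : ℤˣ × Perm (Fin 5)) ∈ L := by
    intro x hx a b h
    have := mul_mem (mul_mem hx h) (inv_mem hx)
    have e : x * (1, swap a b) * x⁻¹ = (1, swap (x.2 a) (x.2 b)) := by
      refine Prod.ext ?_ ?_
      · simp
      · simp [swap_apply_apply]
    rwa [e] at this
  have h34 : ((1, swap 3 4) : ℤˣ × Perm (Fin 5)) ∈ L := hL 0
  have h14 : ((1, swap 1 4) : ℤˣ × Perm (Fin 5)) ∈ L := conj _ (hL 1) 3 4 h34
  have h04 : ((1, swap 0 4) : ℤˣ × Perm (Fin 5)) ∈ L := conj _ (hL 2) 1 4 h14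
  have h24 : ((1, swap 2 4) : ℤˣ × Perm (Fin 5)) ∈ L := conj _ (hL 1) 0 4 h04
  have htop : L.comap (MonoidHom.inr ℤˣ (Perm (Fin 5))) = ⊤ := by
    refine eq_top_of_forall_swap_mem 4 fun a => ?_
    rw [Subgroup.mem_comap, MonoidHom.inr_apply]
    fin_cases a
    · exact h04
    · exact h14
    · exact h24
    · exact h34
    · rw [show swap ((fun i => i) ⟨4, by decide⟩ : Fin 5) 4 = 1 from swap_self 4]
      exact one_mem _
  have hinr : ∀ g, ((1, g) : ℤˣ × Perm (Fin 5)) ∈ L := fun g => by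
    have : g ∈ L.comap (MonoidHom.inr ℤˣ (Perm (Fin 5))) := htop ▸ Subgroup.mem_top g
    exact this
  refine eq_top_iff.2 fun x _ => ?_
  rcases Int.units_eq_one_or x.1 with h | h
  · rw [show x = (1, x.2) from Prod.ext h rfl]
    exact hinr _
  · have := mul_mem (hL 2) (hinr (swap 0 1 * x.2))
    rwa [show facetString 2 * (1, swap 0 1 * x.2) = x from Prod.ext (by simp [facetString, h])
      (by simp [facetString])] at this

/-- The permutations of `Fin 5` which preserve `{1, 3, 4}`. -/
def PreservesTwist (g : Perm (Fin 5)) : Prop :=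
  ∀ i : Fin 5, twist (g i : Fin 5) = twist i

instance (g : Perm (Fin 5)) : Decidable (PreservesTwist g) :=
  inferInstanceAs (Decidable (∀ i : Fin 5, twist (g i : Fin 5) = twist i))

set_option maxRecDepth 100000 in
-- The stabiliser of {1, 3, 4} is Sym(3) × Sym(2), a dihedral group of order 12. It is generated by
-- the two involutions (3 4) and (0 2)(1 3), whose product has order 6.
theorem PreservesTwist.exists_eq_pow_mul_pow : ∀ g : Perm (Fin 5), PreservesTwist g →
    ∃ k : Fin 6, ∃ e : Fin 2,
      (swap 3 4 * (swap 0 2 * swap 1 3)) ^ (k : ℕ) * swap 3 4 ^ (e : ℕ) = g := by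
  decide

set_option maxRecDepth 100000 in
theorem PreservesTwist.eq_one_or_eq_swap : ∀ g : Perm (Fin 5), PreservesTwist g →
    (g 0 = 0 ∨ g 0 = 1) → (g 1 = 0 ∨ g 1 = 1) → g = 1 ∨ g = swap 3 4 := by
  decide

set_option maxRecDepth 100000 in
theorem PreservesTwist.eq_one_or_eq_mul : ∀ g : Perm (Fin 5), PreservesTwist g →
    (∀ i j : Fin 5, (i : ℕ) / 2 = (j : ℕ) / 2 → (g i : ℕ) / 2 = (g j : ℕ) / 2) →
    g = 1 ∨ g = swap 0 2 * swap 1 3 := by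
  decide

set_option maxRecDepth 100000 in
-- For `e = -1` the permutation would exchange {1, 3, 4} with its complement, which has only two
-- elements.
theorem preservesTwist_of_left_eq_one : ∀ (e : ℤˣ) (g : Perm (Fin 5)),
    (∀ i : Fin 5, twist i * twist (g⁻¹ i : Fin 5) * e = 1) → e = 1 ∧ PreservesTwist g := by
  decide

end FacetHom

/-! ### The signed permutations form a C-string -/

section StringOfSignedPerms

open Equiv SemidirectProduct

theorem perm_apply_inv {α : Type*} (g : Perm α) (i : α) : g (g⁻¹ i) = i :=
  g.apply_symm_apply i

namespace SignedPerm

variable {α : Type*}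

theorem commute_inr_inl {g : Perm α} {a : α → ℤˣ} (h : ∀ i, a (g⁻¹ i) = a i) :
    Commute (inr g : SignedPerm α) (inl a) := by
  have := conj_inl g a
  rw [funext h, mul_inv_eq_iff_eq_mul] at this
  exact this

variable [DecidableEq α]

theorem inl_pair_mem {K : Subgroup (SignedPerm α)}
    (hK : ∀ (g : Perm α), ∀ x ∈ K, inr g * x * (inr g)⁻¹ ∈ K) {i j : α} (hij : i ≠ j)
    (h : inl (Pi.mulSingle i (-1) * Pi.mulSingle j (-1)) ∈ K) (i' j' : α) :
    (inl (Pi.mulSingle i' (-1) * Pi.mulSingle j' (-1)) : SignedPerm α) ∈ K := by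
  by_cases hij' : i' = j'
  · subst hij'
    rw [← Pi.mulSingle_mul]
    simp
  · set g : Perm α := swap (swap i i' j) j' * swap i i' with hg
    have e1 : g i = i' := by
      rw [hg, Perm.mul_apply, swap_apply_left, swap_apply_of_ne_of_ne _ hij']
      intro e
      exact hij ((swap i i').injective (by rw [← e, swap_apply_left]))
    have e2 : g j = j' := by
      rw [hg, Perm.mul_apply, swap_apply_left]
    have := hK g _ h
    rw [map_mul inl, ← conj_mul, conj_inl_mulSingle, conj_inl_mulSingle, e1, e2, ← map_mul] at this
    exact this

theorem inl_mem_of_prod_eq_one [Fintype α] {K : Subgroup (SignedPerm α)}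
    (h : ∀ i j, (inl (Pi.mulSingle i (-1) * Pi.mulSingle j (-1)) : SignedPerm α) ∈ K) (k : α)
    {a : α → ℤˣ} (ha : ∏ i, a i = 1) : (inl a : SignedPerm α) ∈ K := by
  -- Each sign is paired with a copy of itself at `k`; the copies multiply to `∏ i, a i = 1`.
  have e : a = ∏ i, (Pi.mulSingle i (a i) * Pi.mulSingle k (a i)) := by
    rw [Finset.prod_mul_distrib, Finset.univ_prod_mulSingle]
    have := map_prod (MonoidHom.mulSingle (fun _ : α => ℤˣ) k) a Finset.univ
    simp only [MonoidHom.mulSingle_apply] at this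
    rw [← this, ha, Pi.mulSingle_one, mul_one]
  rw [e]
  change _ ∈ K.comap inl
  refine Subgroup.prod_mem _ fun i _ => ?_
  rw [Subgroup.mem_comap]
  rcases Int.units_eq_one_or (a i) with e | e
  · rw [e, Pi.mulSingle_one, Pi.mulSingle_one, one_mul, map_one]; exact one_mem _
  · rw [e]; exact h i k

theorem conj_inl_mulSingle' (x : SignedPerm α) (i : α) (e : ℤˣ) :
    x * inl (Pi.mulSingle i e) * x⁻¹ = inl (Pi.mulSingle (x.right i) e) := by
  have hx := inl_left_mul_inr_right x
  set a := x.left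
  set g := x.right
  rw [← hx, mul_inv_rev, ← mul_assoc, mul_assoc (inl a), mul_assoc (inl a), conj_inl_mulSingle,
    ← map_mul, ← map_inv, ← map_mul, mul_comm a, mul_inv_cancel_right]

end SignedPerm

section

variable {n : ℕ} (hn : 5 ≤ n) (hodd : Odd n)

theorem subgroupOn_succ_image (hodd : Odd n) (J : Set (Fin 3)) :
    subgroupOn (signedString n) (Fin.succ '' J) =
      (subgroupOn facetString J).map (facetHom hn) := by
  rw [← subgroupOn_comp]
  simp only [facetHom_facetString hn hodd]
  rw [subgroupOn, subgroupOn, Set.image_image]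

theorem subgroupOn_one_two_three (hodd : Odd n) :
    subgroupOn (signedString n) {1, 2, 3} = (facetHom hn).range := by
  have e : ({1, 2, 3} : Set (Fin 4)) = Fin.succ '' Set.univ := by
    simp [Set.ext_iff, Fin.forall_fin_succ]
  rw [e, subgroupOn_succ_image hn hodd, subgroupOn, Set.image_univ, closure_range_facetString,
    MonoidHom.range_eq_map]

theorem mem_subgroupOn_facetString_zero_one {x : ℤˣ × Perm (Fin 5)} :
    x ∈ subgroupOn facetString {0, 1} ↔ x.1 = 1 ∧ PreservesTwist x.2 := by
  constructor
  · intro hx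
    induction hx using Subgroup.closure_induction with
    | mem y hy =>
      obtain ⟨i, rfl | rfl, rfl⟩ := hy <;> decide
    | one => exact ⟨rfl, fun _ => rfl⟩
    | mul y z _ _ hy hz =>
      exact ⟨by rw [Prod.fst_mul, hy.1, hz.1, one_mul], fun i => (hy.2 _).trans (hz.2 i)⟩
    | inv y _ hy =>
      refine ⟨by rw [Prod.fst_inv, hy.1, inv_one], fun i => ?_⟩
      rw [Prod.snd_inv, ← hy.2 (y.2⁻¹ i), perm_apply_inv]
  · rintro ⟨h1, h2⟩
    obtain ⟨k, e, hg⟩ := h2.exists_eq_pow_mul_pow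
    have hmem : ∀ i ∈ ({0, 1} : Set (Fin 3)), facetString i ∈ subgroupOn facetString {0, 1} :=
      fun i hi => mem_subgroupOn hi
    have : x = (facetString 0 * facetString 1) ^ (k : ℕ) * facetString 0 ^ (e : ℕ) :=
      Prod.ext (by simp [h1, facetString]) hg.symm
    rw [this]
    exact mul_mem (pow_mem (mul_mem (hmem 0 (by simp)) (hmem 1 (by simp))) _)
      (pow_mem (hmem 0 (by simp)) _)

theorem mem_subgroupOn_one_two (hodd : Odd n) {x : SignedPerm (Fin n)} :
    x ∈ subgroupOn (signedString n) {1, 2} ↔ ∃ g, PreservesTwist g ∧ facetHom hn (1, g) = x := by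
  have e : ({1, 2} : Set (Fin 4)) = Fin.succ '' {0, 1} := by simp [Set.image_pair]
  rw [e, subgroupOn_succ_image hn hodd, Subgroup.mem_map]
  constructor
  · rintro ⟨⟨a, g⟩, hy, rfl⟩
    obtain ⟨rfl, h⟩ := mem_subgroupOn_facetString_zero_one.1 hy
    exact ⟨g, h, rfl⟩
  · rintro ⟨g, hg, rfl⟩
    exact ⟨_, mem_subgroupOn_facetString_zero_one.2 ⟨rfl, hg⟩, rfl⟩

include hn hodd

theorem subgroupOn_zero_one_two :
    subgroupOn (signedString n) {0, 1, 2} = (inr : Perm (Fin n) →* SignedPerm (Fin n)).range := by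
  refine le_antisymm ((Subgroup.closure_le _).2 ?_) ?_
  · rintro _ ⟨i, rfl | rfl | rfl, rfl⟩
    · exact ⟨base1 n, rfl⟩
    · exact ⟨base2 n, rfl⟩
    · exact ⟨base3 n, rfl⟩
  · have := eq_top_of_base_mem hodd hn
      (K := (subgroupOn (signedString n) {0, 1, 2}).comap inr)
      (Subgroup.mem_comap.2 (mem_subgroupOn (i := (0 : Fin 4)) (by simp)))
      (Subgroup.mem_comap.2 (mem_subgroupOn (i := (1 : Fin 4)) (by simp)))
      (Subgroup.mem_comap.2 (mem_subgroupOn (i := (2 : Fin 4)) (by simp)))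
    rintro _ ⟨g, rfl⟩
    exact Subgroup.mem_comap.1 (this ▸ Subgroup.mem_top g)

omit hodd in
theorem signedString_commute (i j : Fin 4) (hij : 2 ≤ |((i : ℕ) : ℤ) - ((j : ℕ) : ℤ)|) :
    Commute (signedString n i) (signedString n j) := by
  have h02 : Commute (signedString n 0) (signedString n 2) :=
    (base1_comm_base3 (by omega)).map inr
  have h03 : Commute (signedString n 0) (signedString n 3) := by
    refine Commute.mul_right (SignedPerm.commute_inr_inl fun i => ?_)
      ((base1_comm_base4 n).map inr)
    have h : ((base1 n)⁻¹ i : ℕ) < 2 ↔ (i : ℕ) < 2 := by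
      rw [(inv_eq_of_mul_eq_one_left (involutivePerm_mul_self _) : (base1 n)⁻¹ = base1 n),
        base1_apply]
      split_ifs <;> omega
    simp only [h]
  have h13 : Commute (signedString n 1) (signedString n 3) := by
    refine Commute.mul_right (SignedPerm.commute_inr_inl fun i => ?_)
      ((base2_comm_base4 n).map inr)
    have h : ((base2 n)⁻¹ i : ℕ) < 2 ↔ (i : ℕ) < 2 := by
      rw [(inv_eq_of_mul_eq_one_left (involutivePerm_mul_self _) : (base2 n)⁻¹ = base2 n),
        base2_apply]
      split_ifs <;> omega
    simp only [h]
  have hcases : ∀ i j : Fin 4, 2 ≤ |((i : ℕ) : ℤ) - ((j : ℕ) : ℤ)| →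
      (i = 0 ∧ j = 2) ∨ (i = 2 ∧ j = 0) ∨ (i = 0 ∧ j = 3) ∨ (i = 3 ∧ j = 0) ∨
      (i = 1 ∧ j = 3) ∨ (i = 3 ∧ j = 1) := by decide
  rcases hcases i j hij with ⟨rfl, rfl⟩ | ⟨rfl, rfl⟩ | ⟨rfl, rfl⟩ | ⟨rfl, rfl⟩ | ⟨rfl, rfl⟩ |
    ⟨rfl, rfl⟩
  exacts [h02, h02.symm, h03, h03.symm, h13, h13.symm]

omit hodd in
-- The permutation part of this element is `tail n`, so modulo the central sign change -1 the facet
-- acquires the pure permutation `tail n`.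
theorem facetHom_neg_one_left : (facetHom hn (-1, 1)).left = fun _ => -1 := by
  funext i
  rcases eq_castLE_or_five_le hn i with ⟨j, rfl⟩ | hi
  · rw [facetHom_left_castLE]
    revert j
    decide
  · rw [facetHom_left_of_le hn _ hi]

/-- All permutations are present, and with them the constant vector -1. Multiplied by the signs of
the last generator it gives the sign change at {0, 1}, hence all even sign changes. As `n` is odd,
-1 is an odd sign change, and a single sign change results. -/
theorem closure_range_signedString : Subgroup.closure (Set.range (signedString n)) = ⊤ := by
  set K := Subgroup.closure (Set.range (signedString n))
  have hle : ∀ J, subgroupOn (signedString n) J ≤ K := fun J =>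
    Subgroup.closure_mono (Set.image_subset_range _ _)
  have hinr : ∀ g, inr g ∈ K := fun g =>
    hle {0, 1, 2} (by rw [subgroupOn_zero_one_two hn hodd]; exact ⟨g, rfl⟩)
  have hneg : inl (fun _ => -1) ∈ K := by
    have h1 : facetHom hn (-1, 1) ∈ K :=
      hle {1, 2, 3} (by rw [subgroupOn_one_two_three hn hodd]; exact ⟨_, rfl⟩)
    have h2 := inl_left_mul_inr_right (facetHom hn (-1, 1))
    rw [facetHom_neg_one_left hn] at h2
    rw [← h2] at h1
    exact (Subgroup.mul_mem_cancel_right _ (hinr _)).1 h1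
  have hs : inl (fun i : Fin n => if (i : ℕ) < 2 then (1 : ℤˣ) else -1) ∈ K :=
    (Subgroup.mul_mem_cancel_right _ (hinr _)).1
      (hle {3} (mem_subgroupOn (i := (3 : Fin 4)) rfl))
  have hpair : inl (Pi.mulSingle (⟨0, by omega⟩ : Fin n) (-1) *
      Pi.mulSingle (⟨1, by omega⟩ : Fin n) (-1)) ∈ K := by
    have := mul_mem hneg hs
    rw [← map_mul] at this
    convert this using 2
    funext i
    simp only [Pi.mul_apply, Pi.mulSingle_apply, Fin.ext_iff]
    rcases (by omega : (i : ℕ) = 0 ∨ (i : ℕ) = 1 ∨ 2 ≤ (i : ℕ)) with h | h | h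
    · simp [h]
    · simp [h]
    · rw [if_neg (by omega), if_neg (by omega), if_neg (by omega)]
      decide
  have hpairs := SignedPerm.inl_pair_mem
    (fun g x hx => mul_mem (mul_mem (hinr g) hx) (inv_mem (hinr g)))
    (by simp [Fin.ext_iff]) hpair
  refine SignedPerm.eq_top_of_inr_mem hinr (i := ⟨0, by omega⟩) ?_
  have heven := SignedPerm.inl_mem_of_prod_eq_one hpairs ⟨0, by omega⟩
    (a := (fun _ => -1) * Pi.mulSingle ⟨0, by omega⟩ (-1)) (by
      simp only [Pi.mul_apply]
      rw [Finset.prod_mul_distrib, Finset.prod_const, Finset.card_univ, Fintype.card_fin,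
        hodd.neg_one_pow, Finset.prod_pi_mulSingle']
      simp)
  rw [map_mul] at heven
  exact (Subgroup.mul_mem_cancel_left _ hneg).1 heven

omit hodd in
theorem signedString_zero_ne_one : signedString n 0 ≠ signedString n 1 := by
  intro e
  have h := congrArg (fun g : Perm (Fin n) => (g ⟨0, by omega⟩ : ℕ)) (congrArg right e)
  change (base1 n ⟨0, by omega⟩ : ℕ) = (base2 n ⟨0, by omega⟩ : ℕ) at h
  rw [base1_apply, base2_apply] at h
  simp at h
  omega

theorem signedString_succ_injective : Function.Injective fun i : Fin 3 =>
    signedString n i.succ := by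
  intro i j h
  simp only [← facetHom_facetString hn hodd] at h
  exact (by decide : Function.Injective facetString) (facetHom_injective hn h)

theorem orderOf_signedString (i : Fin 4) : orderOf (signedString n i) = 2 := by
  refine Fin.cases ?_ (fun i => ?_) i
  · refine orderOf_eq_prime ?_ fun e => ?_
    · change (inr (base1 n) : SignedPerm (Fin n)) ^ 2 = 1
      rw [← map_pow, pow_two, base1, involutivePerm_mul_self, map_one]
    · have h := congrArg (fun g : Perm (Fin n) => (g ⟨0, by omega⟩ : ℕ)) (congrArg right e)
      change (base1 n ⟨0, by omega⟩ : ℕ) = 0 at h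
      rw [base1_apply] at h
      simp at h
      omega
  · rw [← facetHom_facetString hn hodd, orderOf_injective _ (facetHom_injective hn)]
    refine orderOf_eq_prime ?_ ?_ <;> revert i <;> decide

theorem hasSchlafliSymbol_signedString :
    HasSchlafliSymbol (signedString n) ![2 * n - 4, 6, 4] := by
  intro i
  refine Fin.cases ?_ (fun i => ?_) i
  · change orderOf (inr (base1 n) * inr (base2 n) : SignedPerm (Fin n)) = 2 * n - 4
    rw [← map_mul, orderOf_injective _ inr_injective, orderOf_base_mul hodd hn]
  · have h : ∀ i : Fin 2, orderOf (facetString i.castSucc * facetString i.succ) = ![6, 4] i := by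
      intro i
      fin_cases i
      · exact (orderOf_eq_iff (by norm_num)).2 (by decide)
      · exact (orderOf_eq_iff (by norm_num)).2 (by decide)
    rw [← Fin.succ_castSucc, ← facetHom_facetString hn hodd, ← facetHom_facetString hn hodd,
      ← map_mul, orderOf_injective _ (facetHom_injective hn), h]
    rfl

omit hodd in
theorem lt_two_iff_of_mem_subgroupOn {x : SignedPerm (Fin n)}
    (hx : x ∈ subgroupOn (signedString n) {0, 1}) (i : Fin n) :
    (x.right i : ℕ) < 2 ↔ (i : ℕ) < 2 := by
  induction hx using Subgroup.closure_induction generalizing i with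
  | mem y hy =>
    obtain ⟨j, rfl | rfl, rfl⟩ := hy
    · change (base1 n i : ℕ) < 2 ↔ _
      rw [base1_apply]
      split_ifs <;> omega
    · change (base2 n i : ℕ) < 2 ↔ _
      rw [base2_apply]
      split_ifs <;> omega
  | one => rfl
  | mul y z _ _ hy hz => exact (hy _).trans (hz i)
  | inv y _ hy =>
    rw [inv_right, ← hy, perm_apply_inv]

omit hn hodd in
theorem div_two_eq_iff_of_mem_subgroupOn {x : ℤˣ × Perm (Fin 5)}
    (hx : x ∈ subgroupOn facetString {1, 2}) (i j : Fin 5) :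
    (x.2 i : ℕ) / 2 = (x.2 j : ℕ) / 2 ↔ (i : ℕ) / 2 = (j : ℕ) / 2 := by
  induction hx using Subgroup.closure_induction generalizing i j with
  | mem y hy =>
    obtain ⟨k, rfl | rfl, rfl⟩ := hy <;> revert i j <;> decide
  | one => rfl
  | mul y z _ _ hy hz => exact (hy _ _).trans (hz i j)
  | inv y _ hy =>
    rw [Prod.snd_inv, ← hy, perm_apply_inv, perm_apply_inv]

theorem isCString_signedString : IsCString (signedString n) := by
  refine IsCString.of_four (orderOf_signedString hn hodd) (closure_range_signedString hn hodd)
    (signedString_commute hn) (signedString_zero_ne_one hn)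
    (fun e => absurd (signedString_succ_injective hn hodd (a₁ := 0) (a₂ := 1) e) (by decide))
    (fun e => absurd (signedString_succ_injective hn hodd (a₁ := 1) (a₂ := 2) e) (by decide))
    ?_ ?_ ?_
  -- The first two generators preserve {0, 1}. A permutation of five points that also preserves {1,
  -- 3, 4} fixes 0 and 1, so it is 1 or (3 4).
  · rintro x ⟨h1, h2⟩
    obtain ⟨g, hg, rfl⟩ := (mem_subgroupOn_one_two hn hodd).1 h2
    have h := fun i => (lt_two_iff_of_mem_subgroupOn hn h1 (Fin.castLE hn i)).2
    simp only [facetHom_right, facetPerm_castLE, Fin.val_castLE] at h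
    have key : ∀ i : Fin 5, (i : ℕ) < 2 → i = 0 ∨ i = 1 := by decide
    rcases hg.eq_one_or_eq_swap _ (key _ (h 0 (by simp))) (key _ (h 1 (by simp))) with rfl | rfl
    · rw [show ((1, 1) : ℤˣ × Perm (Fin 5)) = 1 from rfl, map_one]
      exact one_mem _
    · rw [show ((1, swap 3 4) : ℤˣ × Perm (Fin 5)) = facetString 0 from rfl,
        facetHom_facetString hn hodd]
      exact mem_subgroupOn rfl
  -- The last two generators preserve the blocks {0, 1}, {2, 3}, {4}, which are the classes of `i /
  -- 2`.
  · rintro x ⟨h1, h2⟩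
    obtain ⟨g, hg, rfl⟩ := (mem_subgroupOn_one_two hn hodd).1 h1
    have e : ({2, 3} : Set (Fin 4)) = Fin.succ '' {1, 2} := by simp [Set.image_pair]
    rw [e, subgroupOn_succ_image hn hodd] at h2
    obtain ⟨y, hy, he⟩ := h2
    rw [facetHom_injective hn he] at hy
    rcases hg.eq_one_or_eq_mul _ fun i j => (div_two_eq_iff_of_mem_subgroupOn hy i j).2
      with rfl | rfl
    · rw [show ((1, 1) : ℤˣ × Perm (Fin 5)) = 1 from rfl, map_one]
      exact one_mem _
    · rw [show ((1, swap 0 2 * swap 1 3) : ℤˣ × Perm (Fin 5)) = facetString 1 from rfl,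
        facetHom_facetString hn hodd]
      exact mem_subgroupOn rfl
  · rw [subgroupOn_zero_one_two hn hodd, subgroupOn_one_two_three hn hodd]
    rintro _ ⟨⟨p, hp⟩, ⟨y, rfl⟩⟩
    rw [mem_subgroupOn_one_two hn hodd]
    obtain ⟨h1, h2⟩ := preservesTwist_of_left_eq_one y.1 y.2 fun i => by
      rw [← facetHom_left_castLE hn, ← hp]
      rfl
    exact ⟨y.2, h2, by rw [← h1]⟩

end

end StringOfSignedPerms

/-! ### Proper quotients destroy the C-string when n > 5 -/

section Quotients

open Equiv SemidirectProduct

namespace SignedPerm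

variable {α : Type*} [DecidableEq α]

/-- This is the commutator of `x` with the sign change at `i`. -/
theorem inl_pair_mem_of_mem {K : Subgroup (SignedPerm α)} [K.Normal] {x : SignedPerm α}
    (hx : x ∈ K) (i : α) :
    (inl (Pi.mulSingle (x.right i) (-1) * Pi.mulSingle i (-1)) : SignedPerm α) ∈ K := by
  have h1 : x * (inl (Pi.mulSingle i (-1)) * x⁻¹ * (inl (Pi.mulSingle i (-1)))⁻¹) ∈ K :=
    mul_mem hx (‹K.Normal›.conj_mem _ (inv_mem hx) _)
  rw [← mul_assoc, ← mul_assoc, conj_inl_mulSingle', ← map_inv, ← map_mul, ← Pi.mulSingle_inv] at h1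
  exact h1

/-- Multiplying `a` by its conjugate under `swap i j` cancels all signs except those at `i` and `j`.
-/
theorem inl_pair_mem_of_ne {K : Subgroup (SignedPerm α)} [K.Normal] {a : α → ℤˣ}
    (ha : inl a ∈ K) {i j : α} (hi : a i = -1) (hj : a j = 1) :
    (inl (Pi.mulSingle i (-1) * Pi.mulSingle j (-1)) : SignedPerm α) ∈ K := by
  have h1 := mul_mem ha (‹K.Normal›.conj_mem _ ha (inr (swap i j)))
  rw [conj_inl, ← map_mul, swap_inv] at h1
  convert h1 using 2
  have hij : i ≠ j := by rintro rfl; rw [hi] at hj; exact absurd hj (by decide)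
  funext k
  simp only [Pi.mul_apply]
  by_cases hki : k = i
  · subst hki
    rw [swap_apply_left, Pi.mulSingle_eq_same, Pi.mulSingle_eq_of_ne hij, hi, hj]
  · by_cases hkj : k = j
    · subst hkj
      rw [swap_apply_right, Pi.mulSingle_eq_same, Pi.mulSingle_eq_of_ne hki, hi, hj]
    · rw [swap_apply_of_ne_of_ne hki hkj, Pi.mulSingle_eq_of_ne hki, Pi.mulSingle_eq_of_ne hkj,
        one_mul]
      exact (Int.units_mul_self _).symm

omit [DecidableEq α] in
-- The product of all signs is a homomorphism to an abelian group, so it kills commutators.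
theorem prod_conj_mul_left [Fintype α] (y : SignedPerm α) (g : Perm α) :
    ∏ i, (y * inr g * y⁻¹ * (inr g)⁻¹).left i = 1 := by
  have hmul : ∀ x z : SignedPerm α, ∏ i, (x * z).left i = (∏ i, x.left i) * ∏ i, z.left i := by
    intro x z
    simp only [mul_left_apply, Finset.prod_mul_distrib]
    congr 1
    exact Equiv.prod_comp x.right⁻¹ z.left
  have hinr : ∀ g : Perm α, ∏ i, (inr g : SignedPerm α).left i = 1 := fun g => by simp
  have hinv := hmul y y⁻¹
  rw [mul_inv_cancel] at hinv
  rw [hmul, hmul, hmul, ← map_inv, hinr, hinr, mul_one, mul_one, ← hinv]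
  simp

/-- A normal subgroup not contained in the sign subgroup contains every double transposition. -/
theorem inr_mem_of_normal [Fintype α] (hα : 5 ≤ Nat.card α) {K : Subgroup (SignedPerm α)}
    [K.Normal] {x : SignedPerm α} (hx : x ∈ K) (hx1 : x.right ≠ 1) {a b c d e f : α}
    (h : [a, b, c, d, e, f].Nodup) : inr (swap a b * swap c d) ∈ K := by
  have hpairs : ∀ i j, (inl (Pi.mulSingle i (-1) * Pi.mulSingle j (-1)) : SignedPerm α) ∈ K := by
    obtain ⟨i, hi⟩ : ∃ i, x.right i ≠ i := by
      by_contra hcon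
      push Not at hcon
      exact hx1 (Perm.ext hcon)
    exact inl_pair_mem (fun g y hy => ‹K.Normal›.conj_mem _ hy _) hi
      (inl_pair_mem_of_mem hx i)
  have hN : (K.map (rightHom : SignedPerm α →* Perm α)).Normal :=
    Subgroup.Normal.map ‹_› _ rightHom_surjective
  have hnt : K.map (rightHom : SignedPerm α →* Perm α) ≠ ⊥ := fun hb =>
    hx1 ((Subgroup.mem_bot).1 (hb ▸ Subgroup.mem_map_of_mem rightHom hx))
  have hnt' := (Subgroup.nontrivial_iff_ne_bot _).2 hnt
  have halt := Perm.alternatingGroup_le_of_normal hα hnt'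
  simp only [List.nodup_cons, List.mem_cons, List.not_mem_nil, or_false, not_or] at h
  obtain ⟨⟨hab, hac, had, hae, haf⟩, ⟨hbc, hbd, hbe, hbf⟩, ⟨hcd, hce, hcf⟩, ⟨hde, hdf⟩, hef, -⟩ := h
  have hsign : swap a b * swap e f ∈ alternatingGroup α := by
    rw [Perm.mem_alternatingGroup, Perm.sign_mul, Perm.sign_swap hab, Perm.sign_swap hef]
    rfl
  obtain ⟨y, hy, hyr⟩ := halt hsign
  rw [rightHom_eq_right] at hyr
  -- Conjugation by `g` carries (a b)(e f) to (c d)(e f), so the commutator of `y` and `g` has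
  -- permutation part (a b)(c d). Its signs multiply to 1, so they lie in `K` and can be removed.
  -- The spare points `e`, `f` make (a b)(e f) even.
  set g : Perm α := swap a c * swap b d
  have hz : y * inr g * y⁻¹ * (inr g)⁻¹ ∈ K := by
    rw [mul_assoc, mul_assoc, ← mul_assoc (inr g)]
    exact mul_mem hy (‹K.Normal›.conj_mem _ (inv_mem hy) _)
  have hzr : (y * inr g * y⁻¹ * (inr g)⁻¹).right = swap a b * swap c d := by
    have ga : g a = c := by
      simp only [g, Perm.mul_apply]
      rw [swap_apply_of_ne_of_ne hab had, swap_apply_left]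
    have gb : g b = d := by
      simp only [g, Perm.mul_apply]
      rw [swap_apply_left, swap_apply_of_ne_of_ne (Ne.symm had) (Ne.symm hcd)]
    have ge : g e = e := by
      simp only [g, Perm.mul_apply]
      rw [swap_apply_of_ne_of_ne (Ne.symm hbe) (Ne.symm hde),
        swap_apply_of_ne_of_ne (Ne.symm hae) (Ne.symm hce)]
    have gf : g f = f := by
      simp only [g, Perm.mul_apply]
      rw [swap_apply_of_ne_of_ne (Ne.symm hbf) (Ne.symm hdf),
        swap_apply_of_ne_of_ne (Ne.symm haf) (Ne.symm hcf)]
    have hcomm : Commute (swap c d) (swap e f) := by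
      refine Perm.Disjoint.commute fun k => ?_
      by_cases hk : k = c ∨ k = d
      · right
        rcases hk with rfl | rfl
        · exact swap_apply_of_ne_of_ne hce hcf
        · exact swap_apply_of_ne_of_ne hde hdf
      · left
        rw [not_or] at hk
        exact swap_apply_of_ne_of_ne hk.1 hk.2
    have h1 : g * (swap a b * swap e f) * g⁻¹ = swap c d * swap e f := by
      rw [← conj_mul, ← swap_apply_apply, ← swap_apply_apply, ga, gb, ge, gf]
    have h2 : g * (swap a b * swap e f)⁻¹ * g⁻¹ = swap e f * swap c d := by
      rw [← conj_inv, h1, mul_inv_rev, swap_inv, swap_inv]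
    simp only [mul_right, inv_right, right_inr]
    rw [hyr, mul_assoc (swap a b * swap e f), mul_assoc (swap a b * swap e f), h2, mul_assoc,
      swap_mul_self_mul]
  have hleft := inl_mem_of_prod_eq_one hpairs a (prod_conj_mul_left y g)
  rw [← inl_left_mul_inr_right (y * inr g * y⁻¹ * (inr g)⁻¹), hzr] at hz
  exact (Subgroup.mul_mem_cancel_left _ hleft).1 hz

end SignedPerm

section

variable {n : ℕ} (hn : 5 ≤ n) (hodd : Odd n) {Q : Type*} [Group Q] {f : SignedPerm (Fin n) →* Q}

include hodd

/-- If the image of the string under `f` is a C-string and the kernel consists of sign changes,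
then elements of the facet which agree with a permutation modulo the kernel have the permutation
part of an element of `subgroupOn (signedString n) {1, 2}`. -/
theorem exists_preservesTwist_of_isCString (h : IsCString fun i => f (signedString n i))
    (hker : ∀ x ∈ f.ker, x.right = 1) {x : ℤˣ × Perm (Fin 5)}
    (hx : inl (facetHom hn x).left ∈ f.ker) :
    ∃ g, PreservesTwist g ∧ facetPerm hn (1, g) = facetPerm hn x := by
  have hfx : f (facetHom hn x) = f (inr (facetPerm hn x)) := by
    conv_lhs => rw [← inl_left_mul_inr_right (facetHom hn x), map_mul, MonoidHom.mem_ker.1 hx,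
      one_mul, facetHom_right]
  have hI := h.inter {0, 1, 2} {1, 2, 3}
  have e : ({0, 1, 2} ∩ {1, 2, 3} : Set (Fin 4)) = {1, 2} := by
    simp [Set.ext_iff, Fin.forall_fin_succ]
  rw [e, subgroupOn_comp, subgroupOn_comp, subgroupOn_comp, subgroupOn_zero_one_two hn hodd,
    subgroupOn_one_two_three hn hodd] at hI
  -- Modulo the kernel the facet element is a permutation, so its image lies in both groups of the
  -- intersection property.
  have hmem : f (facetHom hn x) ∈ (subgroupOn (signedString n) {1, 2}).map f := by
    rw [← hI]
    exact ⟨⟨_, ⟨_, rfl⟩, hfx.symm⟩, ⟨_, ⟨_, rfl⟩, rfl⟩⟩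
  obtain ⟨y, hy, hyx⟩ := hmem
  obtain ⟨g, hg, rfl⟩ := (mem_subgroupOn_one_two hn hodd).1 hy
  refine ⟨g, hg, ?_⟩
  have hk : (facetHom hn (1, g))⁻¹ * facetHom hn x ∈ f.ker := by
    rw [MonoidHom.mem_ker, map_mul, map_inv, hyx, inv_mul_cancel]
  have := hker _ hk
  rw [mul_right, inv_right, inv_mul_eq_one] at this
  exact this

/-- No proper quotient map sends the string to a C-string when `n > 5`. -/
theorem not_isCString_of_ker_ne_bot (hn' : 5 < n) (hf : f.ker ≠ ⊥) :
    ¬ IsCString fun i => f (signedString n i) := by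
  have hn : 5 ≤ n := hn'.le
  intro h
  have hn7 : 7 ≤ n := by obtain ⟨m, rfl⟩ := hodd; omega
  by_cases hker : ∀ x ∈ f.ker, x.right = 1
  · obtain ⟨⟨x, hx⟩, hx0⟩ := Subgroup.ne_bot_iff_exists_ne_one.1 hf
    have hx1 : x ≠ 1 := fun e => hx0 (Subtype.ext e)
    have hx2 : inl x.left = x := by
      conv_rhs => rw [← inl_left_mul_inr_right x, hker x hx, map_one, mul_one]
    rw [← hx2] at hx
    by_cases hconst : ∀ i, x.left i = -1
    -- The central -1 is in the kernel, so `tail n` would have to be the permutation part of some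
    -- `(1, g)` with `g = 1`. But `tail n` moves 5 to 6.
    · rw [funext hconst, ← facetHom_neg_one_left hn] at hx
      obtain ⟨g, -, hg⟩ := exists_preservesTwist_of_isCString hn hodd h hker hx
      have h1 : g = 1 := snd_eq_of_facetPerm_eq hn hg
      have h2 := congrArg (fun p : Perm (Fin n) => (p ⟨5, hn'⟩ : ℕ)) hg
      rw [h1] at h2
      rw [facetPerm_of_le hn _ le_rfl, facetPerm_of_le hn _ le_rfl] at h2
      simp only [mul_one, map_one, tailHom_neg_one, Perm.one_apply] at h2
      rw [tail_apply] at h2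
      simp at h2
      omega
    · push Not at hconst
      obtain ⟨j, hj⟩ := hconst
      have hj1 := (Int.units_eq_one_or _).resolve_right hj
      obtain ⟨i, hi⟩ : ∃ i, x.left i = -1 := by
        by_contra hcon
        push Not at hcon
        refine hx1 (hx2 ▸ ?_)
        rw [show x.left = 1 from funext fun i => (Int.units_eq_one_or _).resolve_right (hcon i),
          map_one]
      have hij : i ≠ j := by rintro rfl; exact hj hi
      have hpairs := SignedPerm.inl_pair_mem (K := f.ker)
        (fun g y hy => f.normal_ker.conj_mem _ hy _) hij
        (SignedPerm.inl_pair_mem_of_ne hx hi hj1)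
      -- The signs are quotients of the twist by a permuted twist, so they multiply to 1. The
      -- intersection would then contain (0 1), which does not preserve {1, 3, 4}.
      have hleft : inl (facetHom hn (1, swap 0 1)).left ∈ f.ker := by
        refine SignedPerm.inl_mem_of_prod_eq_one hpairs i ?_
        simp only [facetHom_left, mul_one, Finset.prod_mul_distrib]
        rw [Equiv.prod_comp (facetPerm hn (1, swap 0 1))⁻¹ (fun i : Fin n => twist i),
          Int.units_mul_self]
      obtain ⟨g, hg, hgx⟩ := exists_preservesTwist_of_isCString hn hodd h hker hleft
      have hg1 : g = swap 0 1 := snd_eq_of_facetPerm_eq hn hgx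
      rw [hg1] at hg
      exact absurd hg (by decide)
  -- The kernel contains (0 2)(1 3), the third generator, whose image then is no involution.
  · push Not at hker
    obtain ⟨x, hx, hx1⟩ := hker
    have hmem := SignedPerm.inr_mem_of_normal (by simpa using hn) hx hx1
      (a := ⟨0, by omega⟩) (b := ⟨2, by omega⟩) (c := ⟨1, by omega⟩) (d := ⟨3, by omega⟩)
      (e := ⟨4, by omega⟩) (f := ⟨5, by omega⟩) (by simp [Fin.ext_iff])
    have e : swap (⟨0, by omega⟩ : Fin n) ⟨2, by omega⟩ * swap ⟨1, by omega⟩ ⟨3, by omega⟩ =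
        base3 n := by
      refine Perm.ext fun i => Fin.ext ?_
      rw [base3_apply, Perm.mul_apply]
      simp only [swap_apply_def, Fin.ext_iff]
      split_ifs <;> simp at * <;> omega
    rw [e, MonoidHom.mem_ker] at hmem
    have h2 := h.involution 2
    change orderOf (f (inr (base3 n))) = 2 at h2
    rw [hmem, orderOf_one] at h2
    exact absurd h2 (by decide)

end

end Quotients

/-! ### Matching the explicit permutations of Ω with signed permutations -/

section Labelling

open Equiv SemidirectProduct

/-- The labelling of `Ω` by signed points. -/
def signedPointEquiv (n : ℕ) : Fin n × ℤˣ ≃ Omega n where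
  toFun p := ⟨p.1 + 1 + if p.2 = 1 then 0 else n, by
    have := p.1.2
    rw [Finset.mem_Icc]
    split_ifs <;> omega⟩
  invFun k := (⟨if (k : ℕ) ≤ n then k - 1 else k - n - 1, by
    have := Finset.mem_Icc.1 k.2
    split_ifs <;> omega⟩, if (k : ℕ) ≤ n then 1 else -1)
  left_inv p := by
    obtain ⟨i, s⟩ := p
    have := i.2
    rcases Int.units_eq_one_or s with rfl | rfl
    · refine Prod.ext (Fin.ext ?_) ?_
      · simp only [if_true]
        split_ifs <;> omega
      · simp only [if_true]
        rw [if_pos (by omega)]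
    · have h : ((-1 : ℤˣ) = 1) = False := eq_false (by decide)
      refine Prod.ext (Fin.ext ?_) ?_
      · simp only [h, if_false]
        split_ifs <;> omega
      · simp only [h, if_false]
        rw [if_neg (by omega)]
  right_inv k := by
    have := Finset.mem_Icc.1 k.2
    have h : ((-1 : ℤˣ) = 1) = False := eq_false (by decide)
    refine Subtype.ext ?_
    by_cases hk : (k : ℕ) ≤ n
    · simp only [hk, if_true]
      omega
    · simp only [hk, if_false, h]
      omega

theorem signedPointEquiv_apply (n : ℕ) (p : Fin n × ℤˣ) :
    (signedPointEquiv n p : ℕ) = p.1 + 1 + if p.2 = 1 then 0 else n := rfl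

theorem transp_apply {n a b : ℕ} (ha : 1 ≤ a) (ha' : a ≤ 2 * n) (hb : 1 ≤ b) (hb' : b ≤ 2 * n)
    (k : Omega n) : (transp n a b k : ℕ) = if (k : ℕ) = a then b else if (k : ℕ) = b then a else k := by
  have h : a ∈ Finset.Icc 1 (2 * n) ∧ b ∈ Finset.Icc 1 (2 * n) := by
    simp only [Finset.mem_Icc]; omega
  rw [transp, dif_pos h, swap_apply_def]
  simp only [Subtype.ext_iff]
  split_ifs <;> rfl

section

variable {n : ℕ}

theorem transp_mul_transp_add_apply {a a' b b' : ℕ} (ha : 1 ≤ a) (ha' : a + 1 ≤ n)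
    (haa : a' = a + 1) (hb : b = n + a) (hbb : b' = n + a + 1) (hn : 1 ≤ n) (k : Omega n) :
    ((transp n a a' * transp n b b') k : ℕ) =
      if (k : ℕ) = a ∨ (k : ℕ) = n + a then (k : ℕ) + 1
      else if (k : ℕ) = a + 1 ∨ (k : ℕ) = n + a + 1 then (k : ℕ) - 1 else k := by
  subst haa hb hbb
  rw [Perm.mul_apply, transp_apply ha (by omega) (by omega) (by omega),
    transp_apply (by omega) (by omega) (by omega) (by omega)]
  split_ifs <;> omega

/-- Induction on the number of factors: the appended factor acts first, and its points are fixed by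
all earlier factors. -/
theorem prod_transp_one_apply (m : ℕ) (hm : 2 * m ≤ n) (k : Omega n) :
    ((((List.range m).map fun i =>
      transp n (1 + 2 * i) (2 + 2 * i) * transp n (n + 1 + 2 * i) (n + 2 + 2 * i)).prod k : Omega n)
        : ℕ) =
      if (k : ℕ) ≤ 2 * m then (if (k : ℕ) % 2 = 1 then (k : ℕ) + 1 else (k : ℕ) - 1)
      else if n < (k : ℕ) ∧ (k : ℕ) ≤ n + 2 * m then
        (if ((k : ℕ) - n) % 2 = 1 then (k : ℕ) + 1 else (k : ℕ) - 1) else k := by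
  have h1 : ∀ k : Omega n, 1 ≤ (k : ℕ) ∧ (k : ℕ) ≤ 2 * n := fun k => Finset.mem_Icc.1 k.2
  induction m generalizing k with
  | zero =>
    have := h1 k
    rw [if_neg (by omega), if_neg (by omega)]
    rfl
  | succ m ih =>
    have := h1 k
    rw [List.range_succ, List.map_append, List.prod_append, Perm.mul_apply, ih (by omega)]
    simp only [List.map_cons, List.map_nil, List.prod_cons, List.prod_nil, mul_one]
    have hv := transp_mul_transp_add_apply (n := n) (a := 1 + 2 * m) (a' := 2 + 2 * m)
      (b := n + 1 + 2 * m) (b' := n + 2 + 2 * m) (by omega) (by omega) (by omega) (by omega)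
      (by omega) (by omega) k
    generalize (transp n (1 + 2 * m) (2 + 2 * m) * transp n (n + 1 + 2 * m) (n + 2 + 2 * m)) k = l
      at hv ⊢
    split_ifs at hv <;> rw [hv] <;> split_ifs <;> omega

theorem prod_transp_two_apply (m : ℕ) (hm : 2 * m + 3 ≤ n) (k : Omega n) :
    ((((List.range' 1 m).map fun i =>
      transp n (2 + 2 * i) (3 + 2 * i) * transp n (n + 2 + 2 * i) (n + 3 + 2 * i)).prod k : Omega n)
        : ℕ) =
      if 4 ≤ (k : ℕ) ∧ (k : ℕ) ≤ 2 * m + 3 then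
        (if (k : ℕ) % 2 = 0 then (k : ℕ) + 1 else (k : ℕ) - 1)
      else if n + 4 ≤ (k : ℕ) ∧ (k : ℕ) ≤ n + 2 * m + 3 then
        (if ((k : ℕ) - n) % 2 = 0 then (k : ℕ) + 1 else (k : ℕ) - 1) else k := by
  induction m generalizing k with
  | zero =>
    rw [if_neg (by omega), if_neg (by omega)]
    rfl
  | succ m ih =>
    rw [List.range'_1_concat, List.map_append, List.prod_append, Perm.mul_apply, ih (by omega)]
    simp only [List.map_cons, List.map_nil, List.prod_cons, List.prod_nil, mul_one]
    have hv := transp_mul_transp_add_apply (n := n) (a := 2 + 2 * (1 + m)) (a' := 3 + 2 * (1 + m))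
      (b := n + 2 + 2 * (1 + m)) (b' := n + 3 + 2 * (1 + m)) (by omega) (by omega) (by omega) (by omega)
      (by omega) (by omega) k
    generalize (transp n (2 + 2 * (1 + m)) (3 + 2 * (1 + m)) * transp n (n + 2 + 2 * (1 + m)) (n + 3 + 2 * (1 + m))) k = l
      at hv ⊢
    split_ifs at hv <;> rw [hv] <;> split_ifs <;> omega

theorem prod_transp_four_apply (m : ℕ) (hm : m + 2 ≤ n) (k : Omega n) :
    ((((List.range' 1 m).map fun i => transp n (2 + i) (n + 2 + i)).prod k : Omega n) : ℕ) =
      if 3 ≤ (k : ℕ) ∧ (k : ℕ) ≤ m + 2 then (k : ℕ) + n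
      else if n + 3 ≤ (k : ℕ) ∧ (k : ℕ) ≤ n + m + 2 then (k : ℕ) - n else k := by
  induction m generalizing k with
  | zero =>
    rw [if_neg (by omega), if_neg (by omega)]
    rfl
  | succ m ih =>
    rw [List.range'_1_concat, List.map_append, List.prod_append, Perm.mul_apply, ih (by omega)]
    simp only [List.map_cons, List.map_nil, List.prod_cons, List.prod_nil, mul_one]
    rw [transp_apply (by omega) (by omega) (by omega) (by omega)]
    split_ifs <;> omega

theorem transp_mul_transp_apply {a b : ℕ} (ha : 1 ≤ a) (ha' : a + 1 ≤ 2 * n) (hb : 1 ≤ b)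
    (hb' : b + 1 ≤ 2 * n) (hab : a + 1 < b) (hba : b ≤ a + 2) (k : Omega n) :
    ((transp n a b * transp n (a + 1) (b + 1)) k : ℕ) =
      if (k : ℕ) = a ∨ (k : ℕ) = a + 1 then (k : ℕ) + 2
      else if (k : ℕ) = b ∨ (k : ℕ) = b + 1 then (k : ℕ) - 2 else k := by
  rw [Perm.mul_apply, transp_apply ha (by omega) hb (by omega),
    transp_apply (by omega) ha' (by omega) hb']
  split_ifs <;> omega

theorem perm3_apply (hn : 4 ≤ n) (k : Omega n) : (perm3 n k : ℕ) =
    if (k : ℕ) = 1 ∨ (k : ℕ) = 2 ∨ (k : ℕ) = n + 1 ∨ (k : ℕ) = n + 2 then (k : ℕ) + 2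
    else if (k : ℕ) = 3 ∨ (k : ℕ) = 4 ∨ (k : ℕ) = n + 3 ∨ (k : ℕ) = n + 4 then (k : ℕ) - 2
    else k := by
  rw [perm3, mul_assoc, Perm.mul_apply,
    transp_mul_transp_apply (a := 1) (b := 3) (by omega) (by omega) (by omega) (by omega) (by omega)
      (by omega),
    transp_mul_transp_apply (a := n + 1) (b := n + 3) (by omega) (by omega) (by omega) (by omega)
      (by omega) (by omega)]
  split_ifs <;> omega

theorem perm4_apply (hn : 2 ≤ n) (k : Omega n) : (perm4 n k : ℕ) =
    if (k : ℕ) = 1 ∨ (k : ℕ) = n + 1 then (k : ℕ) + 1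
    else if (k : ℕ) = 2 ∨ (k : ℕ) = n + 2 then (k : ℕ) - 1
    else if (k : ℕ) ≤ n then (k : ℕ) + n else (k : ℕ) - n := by
  have := Finset.mem_Icc.1 k.2
  rw [perm4, Perm.mul_apply, Perm.mul_apply,
    transp_apply (by omega) (by omega) (by omega) (by omega),
    transp_apply (by omega) (by omega) (by omega) (by omega),
    prod_transp_four_apply _ (by omega)]
  split_ifs <;> omega

theorem signedPointEquiv_cases (n : ℕ) (p : Fin n × ℤˣ) :
    (p.2 = 1 ∧ (signedPointEquiv n p : ℕ) = p.1 + 1) ∨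
      (p.2 = -1 ∧ (signedPointEquiv n p : ℕ) = p.1 + 1 + n) := by
  rw [signedPointEquiv_apply]
  rcases Int.units_eq_one_or p.2 with h | h
  · exact Or.inl ⟨h, by rw [if_pos h]⟩
  · exact Or.inr ⟨h, by rw [if_neg (by rw [h]; decide)]⟩

theorem perm1_signedPointEquiv (hodd : Odd n) (hn : 3 ≤ n) (j : Fin n) (s : ℤˣ) :
    perm1 n (signedPointEquiv n (j, s)) = signedPointEquiv n (base1 n j, s) := by
  obtain ⟨m, hm⟩ := hodd
  have hj := j.2
  have hb := base1_apply j
  refine Subtype.ext ?_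
  rw [perm1, prod_transp_one_apply _ (by omega)]
  rcases signedPointEquiv_cases n (j, s) with ⟨h1, h2⟩ | ⟨h1, h2⟩ <;>
  rcases signedPointEquiv_cases n (base1 n j, s) with ⟨h3, h4⟩ | ⟨h3, h4⟩
  · rw [h2, h4, hb]; dsimp only; split_ifs <;> omega
  · exact absurd (h1.symm.trans h3) (by decide)
  · exact absurd (h3.symm.trans h1) (by decide)
  · rw [h2, h4, hb]; dsimp only; split_ifs <;> omega

theorem perm2_signedPointEquiv (hodd : Odd n) (hn : 3 ≤ n) (j : Fin n) (s : ℤˣ) :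
    perm2 n (signedPointEquiv n (j, s)) = signedPointEquiv n (base2 n j, s) := by
  obtain ⟨m, hm⟩ := hodd
  have hj := j.2
  have hb := base2_apply j
  refine Subtype.ext ?_
  rw [perm2, prod_transp_two_apply _ (by omega)]
  rcases signedPointEquiv_cases n (j, s) with ⟨h1, h2⟩ | ⟨h1, h2⟩ <;>
  rcases signedPointEquiv_cases n (base2 n j, s) with ⟨h3, h4⟩ | ⟨h3, h4⟩
  · rw [h2, h4, hb]; dsimp only; split_ifs <;> omega
  · exact absurd (h1.symm.trans h3) (by decide)
  · exact absurd (h3.symm.trans h1) (by decide)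
  · rw [h2, h4, hb]; dsimp only; split_ifs <;> omega

theorem perm3_signedPointEquiv (hn : 4 ≤ n) (j : Fin n) (s : ℤˣ) :
    perm3 n (signedPointEquiv n (j, s)) = signedPointEquiv n (base3 n j, s) := by
  have hj := j.2
  have hb := base3_apply j
  refine Subtype.ext ?_
  rw [perm3_apply hn]
  rcases signedPointEquiv_cases n (j, s) with ⟨h1, h2⟩ | ⟨h1, h2⟩ <;>
  rcases signedPointEquiv_cases n (base3 n j, s) with ⟨h3, h4⟩ | ⟨h3, h4⟩
  · rw [h2, h4, hb]; dsimp only; split_ifs <;> omega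
  · exact absurd (h1.symm.trans h3) (by decide)
  · exact absurd (h3.symm.trans h1) (by decide)
  · rw [h2, h4, hb]; dsimp only; split_ifs <;> omega

theorem perm4_signedPointEquiv (hn : 2 ≤ n) (j : Fin n) (s : ℤˣ) :
    perm4 n (signedPointEquiv n (j, s)) =
      signedPointEquiv n (base4 n j, (if (base4 n j : ℕ) < 2 then 1 else -1) * s) := by
  have hj := j.2
  have hb := base4_apply j
  refine Subtype.ext ?_
  rw [perm4_apply hn]
  rcases Nat.lt_or_ge (j : ℕ) 2 with hj2 | hj2
  · rw [if_pos hj2, if_pos (by omega)] at hb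
    rw [if_pos (show (base4 n j : ℕ) < 2 by omega), one_mul]
    rcases signedPointEquiv_cases n (j, s) with ⟨h1, h2⟩ | ⟨h1, h2⟩ <;>
    rcases signedPointEquiv_cases n (base4 n j, s) with ⟨h3, h4⟩ | ⟨h3, h4⟩
    · rw [h2, h4, hb]; dsimp only; split_ifs <;> omega
    · exact absurd (h1.symm.trans h3) (by decide)
    · exact absurd (h3.symm.trans h1) (by decide)
    · rw [h2, h4, hb]; dsimp only; split_ifs <;> omega
  · rw [if_neg (by omega)] at hb
    rw [if_neg (show ¬(base4 n j : ℕ) < 2 by omega)]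
    rcases signedPointEquiv_cases n (j, s) with ⟨h1, h2⟩ | ⟨h1, h2⟩ <;>
    rcases signedPointEquiv_cases n (base4 n j, -1 * s) with ⟨h3, h4⟩ | ⟨h3, h4⟩ <;>
    simp only at h1 h2 h3 h4 <;> rw [h1] at h3
    · exact absurd h3 (by decide)
    · rw [h2, h4, hb, if_neg (by omega), if_neg (by omega), if_pos (by omega)]
    · rw [h2, h4, hb, if_neg (by omega), if_neg (by omega), if_neg (by omega)]
      omega
    · exact absurd h3 (by decide)

theorem permString_signedPointEquiv (hodd : Odd n) (hn : 5 ≤ n) (i : Fin 4) (p : Fin n × ℤˣ) :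
    permString n i (signedPointEquiv n p) =
      signedPointEquiv n (SignedPerm.toPerm (signedString n i) p) := by
  obtain ⟨j, s⟩ := p
  have hinr : ∀ g : Perm (Fin n), SignedPerm.toPerm (inr g) (j, s) = (g j, s) := fun g => by
    simp [SignedPerm.toPerm_apply]
  fin_cases i
  · exact (perm1_signedPointEquiv hodd (by omega) j s).trans (by rw [← hinr]; rfl)
  · exact (perm2_signedPointEquiv hodd (by omega) j s).trans (by rw [← hinr]; rfl)
  · exact (perm3_signedPointEquiv (by omega) j s).trans (by rw [← hinr]; rfl)
  · refine (perm4_signedPointEquiv (by omega) j s).trans (congrArg _ ?_)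
    change _ = SignedPerm.toPerm (inl _ * inr (base4 n)) (j, s)
    rw [map_mul, Perm.mul_apply, hinr, SignedPerm.toPerm_apply]
    simp

end

end Labelling

/-! ### Transport to the Coxeter group -/

theorem theorem1p2 (n : ℕ) (hodd : Odd n) (hn : 5 ≤ n) :
    ∃ (φ : (CoxeterMatrix.B n).Group →* Equiv.Perm (Omega n))
      (t : Fin 4 → (CoxeterMatrix.B n).Group),
      Function.Injective φ ∧ (∀ i, φ (t i) = permString n i) ∧
      IsCString t ∧
      HasSchlafliSymbol t ![2 * n - 4, 6, 4] ∧
      Nonempty (subgroupOn t {0, 1, 2} ≃* Equiv.Perm (Fin n)) ∧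
      Nonempty (subgroupOn t {1, 2, 3} ≃* Multiplicative (ZMod 2) × Equiv.Perm (Fin 5)) ∧
      (5 < n → IsUnravelledCString t) := by
  have : NeZero n := ⟨by omega⟩
  set Φ := coxeterEquivSignedPerm n
  set t : Fin 4 → (CoxeterMatrix.B n).Group := fun i => Φ.symm (signedString n i)
  have hC : IsCString t := (isCString_signedString hn hodd).map Φ.symm
  have hsub : ∀ J, subgroupOn t J = (subgroupOn (signedString n) J).map Φ.symm.toMonoidHom :=
    fun J => subgroupOn_comp Φ.symm.toMonoidHom (signedString n) J
  have hiso : ∀ J, Nonempty (subgroupOn t J ≃* subgroupOn (signedString n) J) := fun J =>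
    ⟨(MulEquiv.subgroupCongr (hsub J)).trans (Φ.symm.subgroupMap _).symm⟩
  refine ⟨((signedPointEquiv n).permCongrHom.toMonoidHom.comp SignedPerm.toPerm).comp
    Φ.toMonoidHom, t, ?_, fun i => ?_, hC, fun i => ?_, ?_, ?_, fun hn' => ⟨hC, ?_⟩⟩
  · exact ((signedPointEquiv n).permCongrHom.injective.comp SignedPerm.toPerm_injective).comp
      Φ.injective
  · refine Equiv.Perm.ext fun k => ?_
    obtain ⟨p, rfl⟩ := (signedPointEquiv n).surjective k
    rw [permString_signedPointEquiv hodd hn]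
    simp [t]
  · rw [← hasSchlafliSymbol_signedString hn hodd i, ← map_mul, MulEquiv.orderOf_eq]
  · obtain ⟨e⟩ := hiso {0, 1, 2}
    exact ⟨e.trans ((MulEquiv.subgroupCongr (subgroupOn_zero_one_two hn hodd)).trans
      (MonoidHom.ofInjective SemidirectProduct.inr_injective).symm)⟩
  · obtain ⟨e⟩ := hiso {1, 2, 3}
    have e2 : ℤˣ ≃* Multiplicative (ZMod 2) := mulEquivOfPrimeCardEq (p := 2) (by simp) (by simp)
    exact ⟨e.trans ((MulEquiv.subgroupCongr (subgroupOn_one_two_three hn hodd)).trans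
      ((MonoidHom.ofInjective (facetHom_injective hn)).symm.trans
        (MulEquiv.prodCongr e2 (MulEquiv.refl _))))⟩
  · intro N _ hN _
    -- The image of the string has at most four elements, so failing to be a C-string settles both
    -- alternatives of being unravelled at `N`.
    have hnot : ¬ IsCString fun i => (t i : (CoxeterMatrix.B n).Group ⧸ N) := by
      refine not_isCString_of_ker_ne_bot hodd hn'
        (f := (QuotientGroup.mk' N).comp Φ.symm.toMonoidHom) fun hb => hN ?_
      rw [eq_bot_iff]
      intro x hx
      have hx' : Φ x ∈ ((QuotientGroup.mk' N).comp Φ.symm.toMonoidHom).ker := by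
        rw [MonoidHom.mem_ker, MonoidHom.comp_apply]
        simpa using hx
      rw [hb, Subgroup.mem_bot] at hx'
      simpa using hx'
    have hle : (Set.range fun i => (t i : (CoxeterMatrix.B n).Group ⧸ N)).ncard ≤ 4 := by
      rw [← Set.image_univ]
      exact (Set.ncard_image_le Set.finite_univ).trans (by simp)
    rcases hle.lt_or_eq with h | h
    · exact Or.inl h
    · exact Or.inr ⟨h, hnot⟩
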